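/- Let $(S,\mathfrak n,\mathbf k)$ be a complete regular local ring whose residue field $\mathbf k$ is algebraically closed, let $d\ge 2$ be an integer not divisible by the characteristic of $\mathbf k$, and let $0\ne f\in\mathfrak n^2$. Let $\operatorname{ord}(f)$ denote the largest integer $e$ with $f\in\mathfrak n^e$. Assume that $d\le\operatorname{ord}(f)$ and that $f+z^d$ is irreducible in $S[\![z]\!]$, and put $R^\sharp=S[\![z]\!]/(f+z^d)$. A matrix factorization of $f$ with $d$ factors is a tuple $X=(\varphi_1:F_2\to F_1,\ \varphi_2:F_3\to F_2,\dots,\varphi_d:F_1\to F_d)$ of homomorphisms between finitely generated free $S$-modules of the same rank with $\varphi_1\varphi_2\cdots\varphi_d=f\cdot 1_{F_1}$; it is reduced if $\operatorname{Im}\varphi_k\subseteq\mathfrak n F_k$ for all $k$ (indices modulo $d$). A morphism $X\to X'$ is a family of $S$-linear maps $F_k\to F'_k$ commuting with the maps $\varphi_k,\varphi'_k$; isomorphisms, direct sums and indecomposable matrix factorizations are taken in the resulting category. A finitely generated $R^\sharp$-module $N$ is maximal Cohen--Macaulay (MCM) if $N=0$ or $\operatorname{depth}N=\dim R^\sharp$.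 An Ulrich module is an MCM module whose minimal number of generators equals its Hilbert--Samuel multiplicity. There exists $\mu\in S$ with $\mu^d=-1$. Let $\mu$ be any such element and let $N$ be an MCM $R^\sharp$-module. Then $N$ is finitely generated and free over $S$, so that, with $\varphi:N\to N$ the $S$-linear map given by multiplication by $z$, the tuple $N^\flat=(\mu\varphi,\mu\varphi,\dots,\mu\varphi)$ is a matrix factorization of $f$ with $d$ factors; and $N$ is an Ulrich $R^\sharp$-module if and only if $N^\flat$ is reduced. Moreover, there are only finitely many indecomposable reduced matrix factorizations of $f$ with $d$ factors up to isomorphism if and only if there are only finitely many indecomposable Ulrich $R^\sharp$-modules up to isomorphism. -/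

import Mathlib

open IsLocalRing PowerSeries

universe u

/-! ### Modules over a local ring -/

section LocalRing

variable (A : Type*) [CommRing A] [IsLocalRing A]

/-- The depth of a nonzero finitely generated module `M` over a Noetherian local ring `A`: the
supremum of the lengths of the `M`-regular sequences contained in the maximal ideal. -/
noncomputable def moduleDepth (M : Type*) [AddCommGroup M] [Module A M] : ℕ∞ :=
  ⨆ (rs : List A) (_ : (∀ r ∈ rs, r ∈ maximalIdeal A) ∧ RingTheory.Sequence.IsRegular M rs),
    (rs.length : ℕ∞)

/-- A maximal Cohen-Macaulay module over a local ring `A`: a finitely generated module whose depth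
is the Krull dimension of `A`. As usual, the zero module counts as maximal Cohen-Macaulay. -/
def IsMCM (M : Type*) [AddCommGroup M] [Module A M] : Prop :=
  Module.Finite A M ∧ (Subsingleton M ∨ (moduleDepth A M : WithBot ℕ∞) = ringKrullDim A)

/-- The (Hilbert-Samuel) multiplicity `e(M)` of the module `M` over the local ring `A` is `e`:
with `s = dim A`, the sequence `s! * length(M / 𝔪 ^ n M) / n ^ s` converges to `e`. -/
def HasMultiplicity (M : Type*) [AddCommGroup M] [Module A M] (e : ℝ) : Prop :=
  ∃ s : ℕ, ringKrullDim A = s ∧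
    Filter.Tendsto
      (fun n : ℕ => (s.factorial : ℝ) *
        ((Module.length A (M ⧸ (maximalIdeal A ^ n • (⊤ : Submodule A M)))).toNat : ℝ) /
          (n : ℝ) ^ s)
      Filter.atTop (nhds e)

/-- An Ulrich module over a local ring `A`: a maximal Cohen-Macaulay module `M` whose minimal number
of generators equals its multiplicity. -/
def IsUlrich (M : Type*) [AddCommGroup M] [Module A M] : Prop :=
  IsMCM A M ∧ HasMultiplicity A M ((⊤ : Submodule A M).spanFinrank : ℝ)

/-- The order of an element `a` of a local ring: the largest `e` with `a ∈ 𝔪 ^ e`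
(as an element of `ℕ∞`). -/
noncomputable def maxIdealOrder (a : A) : ℕ∞ :=
  ⨆ (e : ℕ) (_ : a ∈ maximalIdeal A ^ e), (e : ℕ∞)

end LocalRing

/-- An indecomposable module: nonzero, and not the direct sum of two nonzero submodules. -/
def IsIndecomposableModule (A : Type*) [CommRing A] (M : Type*) [AddCommGroup M] [Module A M] :
    Prop :=
  Nontrivial M ∧ ∀ p q : Submodule A M, IsCompl p q → p = ⊥ ∨ q = ⊥

/-- Up to isomorphism, the local ring `A` has only finitely many indecomposable Ulrich modules. -/
def HasFiniteUlrichType (A : Type u) [CommRing A] [IsLocalRing A] : Prop :=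
  ∃ (n : ℕ) (M : Fin n → ModuleCat.{u} A), ∀ N : ModuleCat.{u} A,
    IsUlrich A N → IsIndecomposableModule A N → ∃ i, Nonempty (N ≃ₗ[A] M i)

/-! ### Matrix factorizations with `d` factors -/

/-- For maps `φ i : F (i + 1) → F i` indexed cyclically by `i ∈ ZMod d`, the endomorphism of the
product of all the `F i` with `(x i)_i ↦ (φ i (x (i + 1)))_i`. The component at `i` of the
`k`-th iterate sends `x` to `φ i (φ (i + 1) (⋯ (φ (i + k - 1) (x (i + k)))))`. -/
def cyclicMap {S : Type*} [CommRing S] {d : ℕ} {F : ZMod d → Type*}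
    [∀ i, AddCommGroup (F i)] [∀ i, Module S (F i)]
    (φ : ∀ i, F (i + 1) →ₗ[S] F i) : Module.End S (∀ i, F i) :=
  LinearMap.pi fun i => φ i ∘ₗ LinearMap.proj (i + 1)

/-- A matrix factorization of `f` with `d` factors: finitely generated free `S`-modules
`F i` (`i ∈ ZMod d`) of the same rank, and `S`-linear maps `φ i : F (i + 1) → F i` with
`φ 1 ∘ φ 2 ∘ ⋯ ∘ φ d = f • id` on `F 1`. -/
structure MatFac (S : Type u) [CommRing S] (d : ℕ) (f : S) where
  F : ZMod d → Type u
  [instAddCommGroup : ∀ i, AddCommGroup (F i)]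
  [instModule : ∀ i, Module S (F i)]
  [instFree : ∀ i, Module.Free S (F i)]
  [instFinite : ∀ i, Module.Finite S (F i)]
  finrank_eq : ∀ i j, Module.finrank S (F i) = Module.finrank S (F j)
  φ : ∀ i, F (i + 1) →ₗ[S] F i
  comp_eq : ∀ x : (∀ i, F i), (cyclicMap φ ^ d) x 1 = f • x 1

namespace MatFac

attribute [instance] instAddCommGroup instModule instFree instFinite

/-- An isomorphism of matrix factorizations: isomorphisms `X.F i ≃ Y.F i` commuting with the
maps of `X` and `Y`. -/
structure Iso {S : Type u} [CommRing S] {d : ℕ} {f : S} (X Y : MatFac S d f) where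
  equiv : ∀ i, X.F i ≃ₗ[S] Y.F i
  comm : ∀ i (x : X.F (i + 1)), equiv i (X.φ i x) = Y.φ i (equiv (i + 1) x)

theorem cyclicMap_prodMap_pow {S : Type*} [CommRing S] {d : ℕ} {F G : ZMod d → Type*}
    [∀ i, AddCommGroup (F i)] [∀ i, Module S (F i)]
    [∀ i, AddCommGroup (G i)] [∀ i, Module S (G i)]
    (φ : ∀ i, F (i + 1) →ₗ[S] F i) (ψ : ∀ i, G (i + 1) →ₗ[S] G i) (k : ℕ) :
    ∀ (x : ∀ i, F i × G i) (i : ZMod d),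
      (cyclicMap (F := fun i => F i × G i) (fun i => (φ i).prodMap (ψ i)) ^ k) x i =
        ((cyclicMap φ ^ k) (fun j => (x j).1) i, (cyclicMap ψ ^ k) (fun j => (x j).2) i) := by
  induction k with
  | zero => intro x i; simp
  | succ k ih =>
    intro x i
    rw [pow_succ, pow_succ, pow_succ, Module.End.mul_apply, ih]
    rfl

/-- The direct sum of two matrix factorizations. -/
def directSum {S : Type u} [CommRing S] {d : ℕ} {f : S} (X Y : MatFac S d f) : MatFac S d f where
  F i := X.F i × Y.F i
  finrank_eq i j := by
    rcases subsingleton_or_nontrivial S with h | h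
    · simp only [Module.finrank, rank_subsingleton]
    · rw [Module.finrank_prod, Module.finrank_prod, X.finrank_eq i j, Y.finrank_eq i j]
  φ i := (X.φ i).prodMap (Y.φ i)
  comp_eq x := by
    rw [cyclicMap_prodMap_pow, X.comp_eq, Y.comp_eq]
    rfl

/-- The zero matrix factorization. -/
def IsZero {S : Type u} [CommRing S] {d : ℕ} {f : S} (X : MatFac S d f) : Prop :=
  ∀ i, Subsingleton (X.F i)

/-- An indecomposable matrix factorization: nonzero, and not isomorphic to the direct sum of two
nonzero matrix factorizations. -/
def IsIndecomposable {S : Type u} [CommRing S] {d : ℕ} {f : S} (X : MatFac S d f) : Prop :=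
  ¬ X.IsZero ∧ ∀ Y Z : MatFac S d f, Nonempty (X.Iso (Y.directSum Z)) → Y.IsZero ∨ Z.IsZero

/-- A reduced matrix factorization over a local ring: the image of every `φ i` lies in `𝔫 F i`. -/
def IsReduced {S : Type u} [CommRing S] [IsLocalRing S] {d : ℕ} {f : S} (X : MatFac S d f) : Prop :=
  ∀ i, LinearMap.range (X.φ i) ≤ maximalIdeal S • (⊤ : Submodule S (X.F i))

end MatFac

/-- `f` has finite reduced `d`-MF type: up to isomorphism, there are only finitely many
indecomposable reduced matrix factorizations of `f` with `d` factors. -/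
def HasFiniteReducedMFType (S : Type u) [CommRing S] [IsLocalRing S] (d : ℕ) (f : S) : Prop :=
  ∃ (n : ℕ) (X : Fin n → MatFac S d f), ∀ Y : MatFac S d f,
    Y.IsReduced → Y.IsIndecomposable → ∃ i, Nonempty (Y.Iso (X i))

/-! ### The `d`-fold branched cover -/

/-- The `d`-fold branched cover `R♯ = S⟦z⟧ / (f + z ^ d)` of `S / (f)`. -/
abbrev BranchedCover (S : Type u) [CommRing S] (d : ℕ) (f : S) : Type u :=
  S⟦X⟧ ⧸ Ideal.span {(C f + X ^ d : S⟦X⟧)}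

namespace BranchedCover

/-- The class of the variable `z` in `R♯`. -/
noncomputable def z (S : Type u) [CommRing S] (d : ℕ) (f : S) : BranchedCover S d f :=
  Ideal.Quotient.mk _ X

theorem z_pow (S : Type u) [CommRing S] (d : ℕ) (f : S) :
    z S d f ^ d = -algebraMap S (BranchedCover S d f) f := by
  rw [eq_neg_iff_add_eq_zero, add_comm]
  exact Ideal.Quotient.eq_zero_iff_mem.mpr (Ideal.subset_span rfl)

theorem isLocalRing {S : Type u} [CommRing S] [IsLocalRing S] {d : ℕ} {f : S} (hd : 2 ≤ d)
    (hf : f ∈ maximalIdeal S ^ 2) : IsLocalRing (BranchedCover S d f) := by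
  have hf1 : f ∈ maximalIdeal S := Ideal.pow_le_self two_ne_zero hf
  have hne : Ideal.span {(C f + X ^ d : S⟦X⟧)} ≠ ⊤ := by
    rw [Ne, Ideal.span_singleton_eq_top, PowerSeries.isUnit_iff_constantCoeff]
    have : d ≠ 0 := by omega
    simpa [this] using hf1
  have : Nontrivial (BranchedCover S d f) := Ideal.Quotient.nontrivial_iff.mpr hne
  exact IsLocalRing.of_surjective' (Ideal.Quotient.mk _) Ideal.Quotient.mk_surjective

/-- For `μ ∈ S` with `μ ^ d = -1` and an `R♯`-module `N` that is finitely generated and free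
over `S`, the matrix factorization `N♭ = (μ z, …, μ z)` of `f` with `d` factors, where `z` stands
for the `S`-linear multiplication by `z` on `N`. -/
noncomputable def flat {S : Type u} [CommRing S] {d : ℕ} {f : S} (μ : S) (hμ : μ ^ d = -1)
    (N : Type u) [AddCommGroup N] [Module (BranchedCover S d f) N] [Module S N]
    [IsScalarTower S (BranchedCover S d f) N] [Module.Free S N] [Module.Finite S N] :
    MatFac S d f where
  F _ := N
  finrank_eq _ _ := rfl
  φ _ := μ • Algebra.lsmul S S N (z S d f)
  comp_eq x := by
    have key : ∀ (k : ℕ) (x : ZMod d → N) (i : ZMod d),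
        (cyclicMap (S := S) (F := fun _ : ZMod d => N)
          (fun _ => μ • Algebra.lsmul S S N (z S d f)) ^ k) x i =
          μ ^ k • z S d f ^ k • x (i + k) := by
      intro k
      induction k with
      | zero => intro x i; simp
      | succ k ih =>
        intro x i
        rw [pow_succ, Module.End.mul_apply, ih]
        simp only [cyclicMap, LinearMap.pi_apply, LinearMap.comp_apply, LinearMap.proj_apply,
          LinearMap.smul_apply, Algebra.lsmul_coe]
        rw [smul_comm (z S d f ^ k) μ, smul_smul, smul_smul, ← pow_succ, ← pow_succ]
        push_cast
        rw [add_assoc]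
    rw [key, hμ, z_pow]
    simp

end BranchedCover

/-! ### Krull-Schmidt over a complete local ring -/

section KrullSchmidt

open TensorProduct

/-! Write 𝔪 for the maximal ideal of `R♯` and 𝔫 for that of `S`. By Weierstrass division `R♯` is
`S[X]/(X^d + f)`, so an `R♯`-module is an `S`-module with an endomorphism `z` satisfying `z^d = -f`.
Depth over the finite extension `R♯` can be tested on elements of `S`
(`exists_isWeaklyRegular_map_algebraMap`), and a finite module of maximal depth over a regular local
ring is free (`free_of_isWeaklyRegular`). Hence MCM over `R♯` means finite free over `S`.

Since `d ≤ ord f`, the element `z^d = -f` lies in 𝔫^d `R♯`, so 𝔫`R♯` is a reduction of 𝔪: the ideal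
𝔪^(d-1+k) is contained in 𝔫^k `R♯`. The multiplicity of `N` can then be computed with powers of 𝔫,
and the Hilbert function of `S` shows that it is the `S`-rank of `N`, which is the length of `N/𝔫N`
(`hasMultiplicity_finrank`). The minimal number of generators is the length of `N/𝔪N`, and 𝔪 = 𝔫`R♯`
+ (`z`). So `N` is Ulrich exactly when `zN ⊆ 𝔫N` (`isUlrich_iff`), which is reducedness of `N♭`
because `μ` is a unit.

For finite type, a matrix factorization `X` yields the `R♯`-module `X♯ = ⨁ F i`, on which `z` acts
as `ν = μ⁻¹` times the cyclic map. If the `P j` are the indecomposable summands of `X♯`, then `X` is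
a retract of the sum of the `(P j)♭`. Conversely `N` is a retract of `(N♭)♯` through the diagonal
and the average, which needs `d` invertible. Completeness makes endomorphism rings of
indecomposables local, so when an identity is a sum of endomorphisms, one of them is a unit
(`exists_isUnit_of_sum_eq_one`). Thus every indecomposable on one side is a summand of the object
attached to an indecomposable on the other side, and each such object has only finitely many
indecomposable summands up to isomorphism. Matrix factorizations are encoded as modules over a free
algebra, so that one Krull-Schmidt argument serves both sides. -/

theorem isAdicComplete_of_finite (S : Type*) [CommRing S] [IsLocalRing S] [IsNoetherianRing S]
    [IsAdicComplete (maximalIdeal S) S] (M : Type*) [AddCommGroup M] [Module S M]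
    [Module.Finite S M] : IsAdicComplete (maximalIdeal S) M := by
  -- The completion of `M` is a quotient of the completion of `S` tensored with `M`, and `S` is
  -- already complete. Separatedness is Krull's intersection theorem, found by instance search.
  have h : Function.Surjective (AdicCompletion.of (maximalIdeal S) M) := by
    intro y
    obtain ⟨t, rfl⟩ := AdicCompletion.ofTensorProduct_surjective_of_finite (maximalIdeal S) M y
    induction t with
    | zero => exact ⟨0, by simp⟩
    | add a b ha hb =>
      obtain ⟨u, hu⟩ := ha
      obtain ⟨v, hv⟩ := hb
      exact ⟨u + v, by rw [map_add, map_add, hu, hv]⟩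
    | tmul a m =>
      obtain ⟨s, rfl⟩ := AdicCompletion.of_surjective (maximalIdeal S) S a
      refine ⟨s • m, ?_⟩
      rw [AdicCompletion.ofTensorProduct_tmul]
      ext n
      simp
      rfl
  have := AdicCompletion.of_surjective_iff.mp h
  constructor

variable {S : Type*} [CommRing S] [IsLocalRing S] [IsNoetherianRing S]
  [IsAdicComplete (maximalIdeal S) S]

theorem exists_idempotent_sub_mem {C : Type*} [CommRing C] (J : Ideal C) [IsAdicComplete J C]
    (a : C) (ha : a ^ 2 - a ∈ J) : ∃ e : C, IsIdempotentElem e ∧ e - a ∈ J := by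
  have hm : (Polynomial.X ^ 2 - Polynomial.X : Polynomial C).Monic := by
    nontriviality C
    apply Polynomial.Monic.sub_of_left (Polynomial.monic_X_pow 2)
    rw [Polynomial.degree_X_pow, Polynomial.degree_X]
    norm_num
  obtain ⟨e, he, he'⟩ := HenselianRing.is_henselian (I := J) _ hm a (by simpa using ha) (by
    have : Ideal.Quotient.mk J a ^ 2 - Ideal.Quotient.mk J a = 0 := by
      rw [← map_pow, ← map_sub]; exact Ideal.Quotient.eq_zero_iff_mem.mpr ha
    -- The derivative `2a - 1` is its own inverse modulo `J`, since `(2a - 1)^2 = 1 + 4(a^2 - a)`.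
    refine IsUnit.of_mul_eq_one (2 * Ideal.Quotient.mk J a - 1) ?_
    simp
    linear_combination 4 * this)
  refine ⟨e, ?_, he'⟩
  have : e ^ 2 - e = 0 := by simpa [Polynomial.IsRoot] using he
  show e * e = e
  linear_combination this

/-- Fitting's argument in the Artinian ring `C ⧸ J`: with `α` the class of `a`, stabilization of
powers gives `α^(m+1) y = α^m`, so `α^m y^m` is idempotent and lifts to an idempotent of `C`. If the
lift is `0`, then `α` is nilpotent; if it is `1`, then `α` is a unit. Units lift because `J` lies in
the Jacobson radical. -/
theorem isUnit_or_isUnit_one_sub_of_idempotents {C : Type*} [CommRing C] [Algebra S C]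
    [Module.Finite S C] (h : ∀ e : C, IsIdempotentElem e → e = 0 ∨ e = 1) (a : C) :
    IsUnit a ∨ IsUnit (1 - a) := by
  set J := (maximalIdeal S).map (algebraMap S C) with hJ
  have hc : IsAdicComplete J C :=
    (IsAdicComplete.map_algebraMap_iff _ _).mpr (isAdicComplete_of_finite S C)
  have hart : IsArtinianRing (C ⧸ J) := by
    let : Field (S ⧸ maximalIdeal S) := Ideal.Quotient.field _
    have : Module.Finite (S ⧸ maximalIdeal S) (C ⧸ J) :=
      Module.Finite.of_restrictScalars_finite S _ _
    exact IsArtinianRing.of_finite (S ⧸ maximalIdeal S) (C ⧸ J)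
  have hlocal : IsLocalHom (Ideal.Quotient.mk J) :=
    isLocalHom_of_le_jacobson_bot J (IsAdicComplete.le_jacobson_bot J)
  obtain ⟨m, y, hy⟩ := IsArtinian.exists_pow_succ_smul_dvd (M := C ⧸ J) (Ideal.Quotient.mk J a) 1
  set α := Ideal.Quotient.mk J a
  simp only [smul_eq_mul, mul_one] at hy
  have key : ∀ k, α ^ (m + k) * y ^ k = α ^ m := by
    intro k
    induction k with
    | zero => simp
    | succ k ih =>
      calc α ^ (m + (k + 1)) * y ^ (k + 1) = (α ^ (m.succ) * y) * α ^ k * y ^ k := by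
            rw [Nat.succ_eq_add_one]; ring
        _ = α ^ (m + k) * y ^ k := by rw [hy]; ring
        _ = _ := ih
  obtain ⟨b, hb⟩ := Ideal.Quotient.mk_surjective (I := J) (y ^ m)
  have hab : Ideal.Quotient.mk J (a ^ m * b) = α ^ m * y ^ m := by rw [map_mul, map_pow, hb]
  obtain ⟨e, he, hea⟩ := exists_idempotent_sub_mem J (a ^ m * b) (by
    rw [← Ideal.Quotient.eq_zero_iff_mem, map_sub, map_pow, hab]
    linear_combination (y ^ m) * key m)
  have hea' : Ideal.Quotient.mk J e = α ^ m * y ^ m := by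
    rw [← hab]; exact Ideal.Quotient.eq.mpr hea
  rcases h e he with rfl | rfl
  · right
    apply isUnit_of_map_unit (Ideal.Quotient.mk J)
    rw [map_sub, map_one]
    apply IsNilpotent.isUnit_one_sub
    refine ⟨m, ?_⟩
    rw [map_zero] at hea'
    rw [← key m, pow_add]
    linear_combination (-α ^ m) * hea'
  · rcases Nat.eq_zero_or_pos m with rfl | hm
    · left
      apply isUnit_of_map_unit (Ideal.Quotient.mk J)
      exact IsUnit.of_mul_eq_one y (by simpa using hy)
    · left
      apply isUnit_of_map_unit (Ideal.Quotient.mk J)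
      rw [map_one] at hea'
      refine IsUnit.of_mul_eq_one (α ^ (m - 1) * y ^ m) ?_
      rw [hea', ← mul_assoc, ← pow_succ', Nat.sub_add_cancel hm]

/-- The question only involves the commutative subalgebra `S[a]`, which is finite over `S` because
`S` is Noetherian, and whose idempotents are idempotents of `E`. -/
theorem isUnit_or_isUnit_one_sub_of_idempotents' {E : Type*} [Ring E] [Algebra S E]
    [Module.Finite S E] (h : ∀ e : E, IsIdempotentElem e → e = 0 ∨ e = 1) (a : E) :
    IsUnit a ∨ IsUnit (1 - a) := by
  have : IsMulCommutative (Algebra.adjoin S {a}) := Algebra.isMulCommutative_adjoin S (by simp)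
  have hfin : Module.Finite S (Algebra.adjoin S {a}) :=
    inferInstanceAs (Module.Finite S (Subalgebra.toSubmodule (Algebra.adjoin S {a})))
  have := isUnit_or_isUnit_one_sub_of_idempotents (S := S) (C := Algebra.adjoin S {a})
    (fun e he => by
      rcases h e.1 (congrArg Subtype.val he) with h | h
      · exact Or.inl (Subtype.ext h)
      · exact Or.inr (Subtype.ext h)) ⟨a, Algebra.self_mem_adjoin_singleton S a⟩
  exact this.imp (fun h => h.map (Algebra.adjoin S {a}).val)
    (fun h => h.map (Algebra.adjoin S {a}).val)

/-- An indecomposable module over a not necessarily commutative ring. -/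
def IsIndecModule (Λ : Type*) [Ring Λ] (V : Type*) [AddCommGroup V] [Module Λ V] : Prop :=
  Nontrivial V ∧ ∀ p q : Submodule Λ V, IsCompl p q → p = ⊥ ∨ q = ⊥

section

variable {Λ : Type*} [Ring Λ] {V W : Type*} [AddCommGroup V] [Module Λ V] [AddCommGroup W]
  [Module Λ W]

theorem IsIndecModule.idempotent (h : IsIndecModule Λ V) (e : Module.End Λ V)
    (he : IsIdempotentElem e) : e = 0 ∨ e = 1 := by
  rcases h.2 _ _ (LinearMap.IsIdempotentElem.isCompl he) with h | h
  · exact Or.inl (LinearMap.range_eq_bot.mp h)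
  · right
    ext x
    apply LinearMap.ker_eq_bot.mp h
    rw [← Module.End.mul_apply, he.eq, Module.End.one_apply]

theorem IsIndecModule.congr (h : IsIndecModule Λ V) (e : V ≃ₗ[Λ] W) : IsIndecModule Λ W := by
  have := h.1
  refine ⟨e.symm.toEquiv.nontrivial, fun p q hpq => ?_⟩
  have := h.2 (p.comap e.toLinearMap) (q.comap e.toLinearMap)
    (by simpa using hpq.map (Submodule.orderIsoMapComap e).symm)
  simpa [Submodule.comap_equiv_eq_map_symm, Submodule.map_eq_bot_iff] using this

/-- With `u = g ∘ f`, the map `f ∘ u⁻¹ ∘ g` is an idempotent of `End W`. It is nonzero because `f`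
is injective on `V ≠ 0`, so it is `1` and `f` is onto. -/
theorem IsIndecModule.bijective_of_isUnit (hW : IsIndecModule Λ W) [Nontrivial V]
    (f : V →ₗ[Λ] W) (g : W →ₗ[Λ] V) (h : IsUnit (g ∘ₗ f : Module.End Λ V)) :
    Nonempty (V ≃ₗ[Λ] W) := by
  obtain ⟨u, hu⟩ := h
  have h1 : ∀ x, (u⁻¹.1 : Module.End Λ V) (g (f x)) = x := fun x => by
    have : (u⁻¹.1 * u.1 : Module.End Λ V) x = x := by rw [Units.inv_mul]; rfl
    rwa [hu] at this
  have hinj : Function.Injective f := Function.LeftInverse.injective (g := u⁻¹.1 ∘ₗ g) h1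
  have hid : IsIdempotentElem (f ∘ₗ u⁻¹.1 ∘ₗ g : Module.End Λ W) := by
    ext x
    show f (u⁻¹.1 (g (f (u⁻¹.1 (g x))))) = f (u⁻¹.1 (g x))
    rw [h1]
  rcases hW.idempotent _ hid with h | h
  · exfalso
    obtain ⟨x, hx⟩ := exists_ne (0 : V)
    apply hx
    apply hinj
    have := LinearMap.congr_fun h (f x)
    simpa [h1] using this
  · refine ⟨LinearEquiv.ofBijective f ⟨hinj, fun x => ⟨u⁻¹.1 (g x), ?_⟩⟩⟩
    exact LinearMap.congr_fun h x

end

variable {Λ : Type*} [Ring Λ] [Algebra S Λ] {V : Type*} [AddCommGroup V] [Module Λ V]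
  [Module S V] [IsScalarTower S Λ V] [Module.Finite S V]

omit [IsLocalRing S] [IsAdicComplete (maximalIdeal S) S] in
theorem finite_end_of_isScalarTower : Module.Finite S (Module.End Λ V) := by
  refine Module.Finite.of_injective (LinearMap.restrictScalarsₗ S Λ V V S) ?_
  intro a b h
  ext x
  exact LinearMap.congr_fun h x

theorem IsIndecModule.isLocalRing_end (S : Type*) [CommRing S] [IsLocalRing S]
    [IsNoetherianRing S] [IsAdicComplete (maximalIdeal S) S] [Algebra S Λ] [Module S V]
    [IsScalarTower S Λ V] [Module.Finite S V] (h : IsIndecModule Λ V) :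
    IsLocalRing (Module.End Λ V) := by
  have := h.1
  have := finite_end_of_isScalarTower (S := S) (Λ := Λ) (V := V)
  exact IsLocalRing.of_isUnit_or_isUnit_one_sub_self
    (isUnit_or_isUnit_one_sub_of_idempotents' (S := S) h.idempotent)

theorem exists_isUnit_of_sum_eq_one {E : Type*} [Ring E] [IsLocalRing E] {ι : Type*}
    (s : Finset ι) (a : ι → E) (h : IsUnit (∑ i ∈ s, a i)) : ∃ i ∈ s, IsUnit (a i) := by
  classical
  induction s using Finset.induction_on with
  | empty => simp at h
  | insert i s hi ih =>
    rw [Finset.sum_insert hi] at h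
    obtain ⟨u, hu⟩ := h
    have : (u⁻¹.1 * a i) + (u⁻¹.1 * ∑ i ∈ s, a i) = 1 := by
      rw [← mul_add, ← hu, Units.inv_mul]
    rcases IsLocalRing.isUnit_or_isUnit_of_add_one this with h | h
    · exact ⟨i, by simp, by simpa using h⟩
    · obtain ⟨j, hj, hj'⟩ := ih (by simpa using h)
      exact ⟨j, by simp [hj], hj'⟩

/-- The unit `g ∘ f` is the sum of its passages through the `P j`. As `End Y` is local, one passage
is already a unit, and it exhibits `Y` as a summand of an indecomposable `P j`. -/
theorem IsIndecModule.exists_equiv_of_retract {ι : Type*} [Fintype ι] {Y : Type*}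
    [AddCommGroup Y] [Module Λ Y] [Nontrivial Y] [IsLocalRing (Module.End Λ Y)]
    {V : Type*} [AddCommGroup V] [Module Λ V] (P : ι → Submodule Λ V) (p : ∀ j, V →ₗ[Λ] P j)
    (hsum : ∀ x, ∑ j, (p j x : V) = x) (hP : ∀ j, IsIndecModule Λ (P j))
    (f : Y →ₗ[Λ] V) (g : V →ₗ[Λ] Y) (h : IsUnit (g ∘ₗ f : Module.End Λ Y)) :
    ∃ j, Nonempty (Y ≃ₗ[Λ] P j) := by
  have key : ∑ j, ((g ∘ₗ (P j).subtype) ∘ₗ (p j ∘ₗ f) : Module.End Λ Y) = g ∘ₗ f := by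
    ext x
    simp only [LinearMap.sum_apply, LinearMap.comp_apply, Submodule.subtype_apply]
    rw [← map_sum, hsum]
  rw [← key] at h
  obtain ⟨j, -, hj⟩ := exists_isUnit_of_sum_eq_one _ _ h
  exact ⟨j, (hP j).bijective_of_isUnit _ _ hj⟩

omit [IsNoetherianRing S] [IsAdicComplete (maximalIdeal S) S] in
-- Splitting terminates because the dimension of `V` tensored with the residue field is additive
-- and, by Nakayama, positive on nonzero summands.
theorem exists_indecomposable_decomposition_aux (S : Type*) [CommRing S] [IsLocalRing S]
    [Algebra S Λ] (n : ℕ) : ∀ (V : Type u) [AddCommGroup V] [Module Λ V]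
    [Module S V] [IsScalarTower S Λ V] [Module.Finite S V]
    (_ : Module.finrank (ResidueField S) (ResidueField S ⊗[S] V) ≤ n),
    ∃ (ι : Type) (_ : Fintype ι) (P : ι → Submodule Λ V) (p : ∀ j, V →ₗ[Λ] P j),
      (∀ j (x : P j), p j x = x) ∧ (∀ x, ∑ j, (p j x : V) = x) ∧
      ∀ j, IsIndecModule Λ (P j) := by
  induction n with
  | zero =>
    intro V _ _ _ _ _ hV
    have : Subsingleton (ResidueField S ⊗[S] V) :=
      Module.finrank_zero_iff.mp (Nat.le_zero.mp hV)
    have : Subsingleton V := IsLocalRing.subsingleton_tensorProduct.mp this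
    exact ⟨Empty, inferInstance, fun _ => ⊥, fun _ => 0, fun j => j.elim,
      fun x => Subsingleton.elim _ _, fun j => j.elim⟩
  | succ n ih =>
    intro V _ _ _ _ _ hV
    rcases subsingleton_or_nontrivial V with hs | hn
    · exact ⟨Empty, inferInstance, fun _ => ⊥, fun _ => 0, fun j => j.elim,
        fun x => Subsingleton.elim _ _, fun j => j.elim⟩
    by_cases hind : IsIndecModule Λ V
    · refine ⟨Unit, inferInstance, fun _ => ⊤, fun _ => Submodule.topEquiv.symm.toLinearMap,
        fun _ x => rfl, fun x => by simp, fun _ => hind.congr Submodule.topEquiv.symm⟩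
    simp only [IsIndecModule, hn, true_and, not_forall, not_or] at hind
    obtain ⟨A, B, hAB, hA, hB⟩ := hind
    have e := Submodule.prodEquivOfIsCompl A B hAB
    let eS : (A × B) ≃ₗ[S] V := e.restrictScalars S
    have hfA : Module.Finite S A :=
      Module.Finite.of_surjective (LinearMap.fst S A B ∘ₗ eS.symm.toLinearMap)
        (Prod.fst_surjective (β := B) |>.comp eS.symm.surjective)
    have hfB : Module.Finite S B :=
      Module.Finite.of_surjective (LinearMap.snd S A B ∘ₗ eS.symm.toLinearMap)
        (Prod.snd_surjective (α := A) |>.comp eS.symm.surjective)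
    have hrank : Module.finrank (ResidueField S) (ResidueField S ⊗[S] A) +
        Module.finrank (ResidueField S) (ResidueField S ⊗[S] B) =
        Module.finrank (ResidueField S) (ResidueField S ⊗[S] V) := by
      rw [← Module.finrank_prod]
      exact LinearEquiv.finrank_eq
        ((TensorProduct.prodRight S (ResidueField S) (ResidueField S) A B).symm ≪≫ₗ
          eS.baseChange S (ResidueField S) _ _)
    have hpos : ∀ C : Submodule Λ V, C ≠ ⊥ → Module.Finite S C →
        0 < Module.finrank (ResidueField S) (ResidueField S ⊗[S] C) := by
      intro C hC _
      rw [Nat.pos_iff_ne_zero]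
      intro h0
      have : Subsingleton (ResidueField S ⊗[S] C) := Module.finrank_zero_iff.mp h0
      have : Subsingleton C := IsLocalRing.subsingleton_tensorProduct.mp this
      exact hC (Submodule.subsingleton_iff_eq_bot.mp this)
    have hA0 := hpos A hA hfA
    have hB0 := hpos B hB hfB
    obtain ⟨ι, _, P, p, hp, hsum, hP⟩ := ih A (by omega)
    obtain ⟨κ, _, Q, q, hq, hsum', hQ⟩ := ih B (by omega)
    let πA : V →ₗ[Λ] A := A.projectionOnto B hAB
    let πB : V →ₗ[Λ] B := B.projectionOnto A hAB.symm
    refine ⟨ι ⊕ κ, inferInstance, Sum.elim (fun i => (P i).map A.subtype)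
      (fun i => (Q i).map B.subtype), fun j => match j with
        | .inl i => (A.equivSubtypeMap (P i)).toLinearMap ∘ₗ p i ∘ₗ πA
        | .inr i => (B.equivSubtypeMap (Q i)).toLinearMap ∘ₗ q i ∘ₗ πB, ?_, ?_, ?_⟩
    · rintro (i | i) ⟨x, y, hy, rfl⟩
      · have : πA y = y := Submodule.projectionOnto_apply_left hAB y
        apply Subtype.ext
        refine (congrArg (fun z : A => ((p i z : A) : V)) this).trans ?_
        exact congrArg (fun z : P i => ((z : A) : V)) (hp i ⟨y, hy⟩)
      · have : πB y = y := Submodule.projectionOnto_apply_left hAB.symm y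
        apply Subtype.ext
        refine (congrArg (fun z : B => ((q i z : B) : V)) this).trans ?_
        exact congrArg (fun z : Q i => ((z : B) : V)) (hq i ⟨y, hy⟩)
    · intro x
      rw [Fintype.sum_sum_type]
      have h1 : (πA x : V) + πB x = x := by
        exact Submodule.projection_add_projection_eq_self hAB x
      conv_rhs => rw [← h1, ← hsum (πA x), ← hsum' (πB x)]
      simp
      rfl
    · rintro (i | i)
      · exact (hP i).congr (A.equivSubtypeMap (P i))
      · exact (hQ i).congr (B.equivSubtypeMap (Q i))

omit [IsNoetherianRing S] [IsAdicComplete (maximalIdeal S) S] in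
/-- A module that is finite over a local ring is a finite direct sum of indecomposables. -/
theorem exists_indecomposable_decomposition (S : Type*) [CommRing S] [IsLocalRing S]
    [Algebra S Λ] (V : Type u) [AddCommGroup V] [Module Λ V]
    [Module S V] [IsScalarTower S Λ V] [Module.Finite S V] :
    ∃ (ι : Type) (_ : Fintype ι) (P : ι → Submodule Λ V) (p : ∀ j, V →ₗ[Λ] P j),
      (∀ j (x : P j), p j x = x) ∧ (∀ x, ∑ j, (p j x : V) = x) ∧
      ∀ j, IsIndecModule Λ (P j) :=
  exists_indecomposable_decomposition_aux S _ V le_rfl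

end KrullSchmidt

/-! ### Regular systems of parameters -/

section RegularLocal

theorem Ideal.sup_pow_succ_le {R : Type*} [CommRing R] (A B : Ideal R) (k : ℕ) :
    (A ⊔ B) ^ (k + 1) ≤ A * (A ⊔ B) ^ k ⊔ B ^ (k + 1) := by
  induction k with
  | zero => simp
  | succ k ih =>
    calc (A ⊔ B) ^ (k + 1 + 1) = A * (A ⊔ B) ^ (k + 1) ⊔ B * (A ⊔ B) ^ (k + 1) := by
          rw [pow_succ' (A ⊔ B) (k + 1), Ideal.sup_mul]
      _ ≤ A * (A ⊔ B) ^ (k + 1) ⊔ B ^ (k + 1 + 1) := by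
          refine sup_le le_sup_left ?_
          refine (Ideal.mul_mono_right ih).trans ?_
          rw [Ideal.mul_sup]
          refine sup_le (le_sup_of_le_left ?_) (le_sup_of_le_right (by rw [pow_succ' B (k + 1)]))
          rw [mul_left_comm, pow_succ']
          exact Ideal.mul_mono_right (Ideal.mul_mono_left le_sup_right)

/-! ### Regularity modulo powers of ideals generated by parameters. -/

section Colon

/-- The inductive step on the exponent, for `J = (s) + J'`. By `ihk`, modulo `b` one has `a = s d +
c` with `d ∈ J^l` and `c ∈ J'^(l+1)`, while `t a = s e + c'` with `e` and `c'` one power deeper.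
Cancelling `s` by `hA` puts `t d - e` in `b + J'^(l+1)`, so `ihk` improves `d` by one power. The
remaining `c` is treated modulo `s` by `hBx`, and the multiple of `s` that appears there again by
`hA`. -/
theorem mem_sup_pow_of_mul_mem_aux {R : Type*} [CommRing R] (b J' J : Ideal R) (s t : R)
    (hspan : J = Ideal.span {s} ⊔ J')
    (hA : ∀ m y, s * y ∈ b ⊔ J' ^ m → y ∈ b ⊔ J' ^ m)
    (hBx : ∀ m y, t * y ∈ (Ideal.span {s} ⊔ b) ⊔ J' ^ m → y ∈ (Ideal.span {s} ⊔ b) ⊔ J' ^ m)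
    (l : ℕ) (ihk : ∀ a, t * a ∈ b ⊔ J ^ (l + 1) → a ∈ b ⊔ J ^ (l + 1)) (a : R)
    (ha : t * a ∈ b ⊔ J ^ (l + 1 + 1)) : a ∈ b ⊔ J ^ (l + 1 + 1) := by
  have hJ'J : J' ≤ J := by rw [hspan]; exact le_sup_right
  have hxJ : s ∈ J := by
    rw [hspan]; exact Ideal.mem_sup_left (Ideal.mem_span_singleton_self s)
  have hmono : ∀ m : ℕ, b ⊔ J' ^ m ≤ b ⊔ J ^ m := fun m =>
    sup_le_sup_left (Ideal.pow_right_mono hJ'J m) b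
  have hdec : ∀ m, ∀ y ∈ J ^ (m + 1), ∃ e ∈ J ^ m, ∃ c ∈ J' ^ (m + 1), y = s * e + c := by
    intro m y hy
    rw [hspan] at hy
    have := Ideal.sup_pow_succ_le _ _ m hy
    rw [← hspan] at this
    obtain ⟨u, hu, c, hc, rfl⟩ := Submodule.mem_sup.mp this
    obtain ⟨e, he, rfl⟩ := Ideal.mem_span_singleton_mul.mp hu
    exact ⟨e, he, c, hc, rfl⟩
  have hxi : ∀ m y, y ∈ b ⊔ J ^ m → s * y ∈ b ⊔ J ^ (m + 1) := by
    intro m y hy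
    obtain ⟨u, hu, v, hv, rfl⟩ := Submodule.mem_sup.mp hy
    rw [mul_add, pow_succ']
    exact Submodule.add_mem_sup (Ideal.mul_mem_left _ _ hu) (Ideal.mul_mem_mul hxJ hv)
  have hle : J' ^ (l + 1 + 1) ≤ J' ^ (l + 1) := Ideal.pow_le_pow_right (Nat.le_succ (l + 1))
  have ha' : a ∈ b ⊔ J ^ (l + 1) := ihk a
    (sup_le_sup_left (Ideal.pow_le_pow_right (Nat.le_succ (l + 1))) b ha)
  obtain ⟨β, hβ, y, hy, rfl⟩ := Submodule.mem_sup.mp ha'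
  obtain ⟨d, hd, c, hc, rfl⟩ := hdec l y hy
  obtain ⟨γ, hγ, y', hy', hγy⟩ := Submodule.mem_sup.mp ha
  obtain ⟨e, he, c', hc', rfl⟩ := hdec (l + 1) y' hy'
  have h1 : t * d - e ∈ b ⊔ J' ^ (l + 1) := by
    apply hA (l + 1)
    have : s * (t * d - e) = (γ - t * β) + (c' - t * c) := by
      linear_combination -hγy
    rw [this]
    exact Submodule.add_mem_sup (b.sub_mem hγ (b.mul_mem_left _ hβ))
      ((J' ^ (l + 1)).sub_mem (hle hc')
        (Ideal.mul_mem_left _ _ hc))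
  have h2 : d ∈ b ⊔ J ^ (l + 1) := by
    apply ihk
    have := Ideal.add_mem _ (hmono _ h1) (Ideal.mem_sup_right (S := b) he)
    simpa using this
  have h3 := hxi _ _ h2
  have h4 : t * c ∈ b ⊔ J ^ (l + 1 + 1) := by
    have : t * c = (γ + (s * e + c')) - t * β - t * (s * d) := by
      linear_combination -hγy
    rw [this, hγy]
    exact Ideal.sub_mem _ (Ideal.sub_mem _ ha (Ideal.mul_mem_left _ _ (Ideal.mem_sup_left hβ)))
      (Ideal.mul_mem_left _ _ h3)
  have h5 : c ∈ (Ideal.span {s} ⊔ b) ⊔ J' ^ (l + 1 + 1) := by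
    apply hBx
    refine (sup_le ?_ ?_ : b ⊔ J ^ (l + 1 + 1) ≤ _) h4
    · exact le_sup_of_le_left le_sup_right
    · rw [hspan]
      refine (Ideal.sup_pow_succ_le (Ideal.span {s}) J' (l + 1)).trans (sup_le_sup_right ?_ _)
      exact le_sup_of_le_left Ideal.mul_le_left
  have h6 : c ∈ b ⊔ J ^ (l + 1 + 1) := by
    obtain ⟨u, hu, c'', hc'', huc⟩ := Submodule.mem_sup.mp h5
    obtain ⟨v, hv, w, hw, rfl⟩ := Submodule.mem_sup.mp hu
    obtain ⟨g, rfl⟩ := Ideal.mem_span_singleton'.mp hv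
    have hg : g ∈ b ⊔ J' ^ (l + 1) := by
      apply hA (l + 1)
      have : s * g = -w + (c - c'') := by linear_combination huc
      rw [this]
      exact Submodule.add_mem_sup (b.neg_mem hw) ((J' ^ (l + 1)).sub_mem hc
        (hle hc''))
    have h7 := hxi _ _ (hmono _ hg)
    rw [← huc, mul_comm]
    exact Ideal.add_mem _ (Ideal.add_mem _ h7 (Ideal.mem_sup_left hw))
      (Ideal.mem_sup_right (Ideal.pow_right_mono hJ'J _ hc''))
  rw [← add_assoc]
  exact Ideal.add_mem _ (Ideal.add_mem _ (Ideal.mem_sup_left hβ) h3) h6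


variable {R : Type*} [CommRing R] {ι : Type*} [DecidableEq ι] (x : ι → R)

/-- If every `x j` is a nonzerodivisor modulo every ideal generated by other members of the family
`x`, then it is a nonzerodivisor modulo the powers of such ideals. -/
theorem mem_sup_pow_of_mul_mem
    (H : ∀ (I : Finset ι) (j : ι), j ∉ I → ∀ a, x j * a ∈ Ideal.span (x '' I) →
      a ∈ Ideal.span (x '' I)) (I : Finset ι) :
    ∀ (B : Finset ι), Disjoint B I → ∀ j, j ∉ B → j ∉ I → ∀ (k : ℕ) (a : R),
      x j * a ∈ Ideal.span (x '' B) ⊔ Ideal.span (x '' I) ^ k →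
      a ∈ Ideal.span (x '' B) ⊔ Ideal.span (x '' I) ^ k := by
  induction I using Finset.induction_on with
  | empty =>
    intro B _ j hj _ k a h
    rcases k with _ | k
    · simp
    · simp only [Finset.coe_empty, Set.image_empty, Ideal.span_empty, ne_eq, Nat.add_eq_zero_iff,
        one_ne_zero, and_false, not_false_eq_true, bot_le, sup_of_le_left, Ideal.bot_pow] at h ⊢
      exact H B j hj a h
  | insert i I hi ih =>
    intro B hB j hjB hjI k
    rw [Finset.disjoint_insert_right] at hB
    rw [Finset.mem_insert, not_or] at hjI
    have hspan : Ideal.span (x '' (insert i I : Finset ι)) =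
        Ideal.span {x i} ⊔ Ideal.span (x '' I) := by
      rw [Finset.coe_insert, Set.image_insert_eq, Ideal.span_insert]
    have hspanB : Ideal.span (x '' (insert i B : Finset ι)) =
        Ideal.span {x i} ⊔ Ideal.span (x '' B) := by
      rw [Finset.coe_insert, Set.image_insert_eq, Ideal.span_insert]
    have hBi : Disjoint (insert i B) I := Finset.disjoint_insert_left.mpr ⟨hi, hB.2⟩
    set b := Ideal.span (x '' (B : Set ι))
    set J' := Ideal.span (x '' (I : Set ι))
    set J := Ideal.span (x '' ((insert i I : Finset ι) : Set ι))
    induction k with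
    | zero => intro a _; simp
    | succ k ihk =>
      intro a ha
      -- Exponent 1 is the hypothesis `H` for the union `B ∪ insert i I`. From exponent 2 on, the
      -- induction over `I` is applied to `x i` modulo `B` and to `x j` modulo `insert i B`; this is
      -- why `B` and `j` stay quantified in the induction.
      rcases k with _ | l
      · have h1 := H (B ∪ insert i I) j (by simp [hjB, hjI]) a
        have h2 : Ideal.span (x '' ((B ∪ insert i I : Finset ι) : Set ι)) = b ⊔ J := by
          rw [Finset.coe_union, Set.image_union, Ideal.span_union]
        rw [h2] at h1
        simpa using h1 (by simpa using ha)
      refine mem_sup_pow_of_mul_mem_aux b J' J (x i) (x j) hspan ?_ ?_ l ihk a ha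
      · exact fun m y => ih B hB.2 i hB.1 hi m y
      · intro m y
        rw [← hspanB]
        exact ih _ hBi j (by simp [hjI.1, hjB]) hjI.2 m y

end Colon

/-! ### Quotients by parameters; regular local rings are domains. -/

section Parameters

variable {S : Type u} [CommRing S]

section

variable [IsLocalRing S] [IsNoetherianRing S] {ι : Type*} [Fintype ι] [DecidableEq ι]

omit [IsNoetherianRing S] in
theorem isLocalRing_quotient_of_le (I : Ideal S) (hI : I ≤ maximalIdeal S) :
    IsLocalRing (S ⧸ I) := by
  have : Nontrivial (S ⧸ I) := Ideal.Quotient.nontrivial_iff.mpr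
    (ne_top_of_le_ne_top (Ideal.IsPrime.ne_top inferInstance) hI)
  exact IsLocalRing.of_surjective' _ Ideal.Quotient.mk_surjective

omit [IsNoetherianRing S] in
theorem map_maximalIdeal_quotient (I : Ideal S) [IsLocalRing (S ⧸ I)] :
    (maximalIdeal S).map (Ideal.Quotient.mk I) = maximalIdeal (S ⧸ I) := by
  have hloc : IsLocalHom (Ideal.Quotient.mk I) :=
    IsLocalHom.of_surjective _ Ideal.Quotient.mk_surjective
  rw [← IsLocalRing.maximalIdeal_comap (Ideal.Quotient.mk I),
    Ideal.map_comap_of_surjective _ Ideal.Quotient.mk_surjective]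

variable (x : ι → S) (hx : Ideal.span (Set.range x) = maximalIdeal S)
include hx

omit [IsNoetherianRing S] in
theorem spanFinrank_maximalIdeal_quotient_le (I : Ideal S) [IsLocalRing (S ⧸ I)]
    (T : Finset ι) (hT : ∀ i ∈ T, x i ∈ I) :
    (maximalIdeal (S ⧸ I)).spanFinrank ≤ Fintype.card ι - T.card := by
  have h : maximalIdeal (S ⧸ I) =
      Ideal.span ((fun i => Ideal.Quotient.mk I (x i)) '' ((Finset.univ \ T : Finset ι) : Set ι)) := by
    rw [← map_maximalIdeal_quotient, ← hx, Ideal.map_span]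
    apply le_antisymm
    · rw [Ideal.span_le]
      rintro _ ⟨_, ⟨i, rfl⟩, rfl⟩
      by_cases hi : i ∈ T
      · rw [Ideal.Quotient.eq_zero_iff_mem.mpr (hT i hi)]
        exact Ideal.zero_mem _
      · exact Ideal.subset_span ⟨i, by simp [hi], rfl⟩
    · apply Ideal.span_mono
      rintro _ ⟨i, _, rfl⟩
      exact ⟨_, ⟨i, rfl⟩, rfl⟩
  rw [h]
  refine (Submodule.spanFinrank_span_le_ncard_of_finite ((Finset.finite_toSet _).image _)).trans ?_
  refine (Set.ncard_image_le (Finset.finite_toSet _)).trans ?_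
  rw [Set.ncard_coe_finset, Finset.card_sdiff_of_subset (Finset.subset_univ T), Finset.card_univ]

variable (hdim : ringKrullDim S = Fintype.card ι)
include hdim

omit [DecidableEq ι] in
theorem card_le_ringKrullDim_quotient (T : Finset ι) :
    (Fintype.card ι - T.card : ℕ) ≤ ringKrullDim (S ⧸ Ideal.span (x '' T)) := by
  have hmem : ∀ i, x i ∈ maximalIdeal S := fun i => hx ▸ Ideal.subset_span ⟨i, rfl⟩
  have hle : Ideal.span (x '' T) ≤ maximalIdeal S := by
    rw [Ideal.span_le]; rintro _ ⟨i, _, rfl⟩; exact hmem i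
  have := isLocalRing_quotient_of_le _ hle
  have h := ringKrullDim_le_ringKrullDim_quotient_add_spanFinrank (Ideal.span (x '' T))
    (by rwa [ringJacobson_eq_maximalIdeal])
  have h2 : (Ideal.span (x '' T)).spanFinrank ≤ T.card :=
    (Submodule.spanFinrank_span_le_ncard_of_finite ((Finset.finite_toSet _).image _)).trans
      ((Set.ncard_image_le (Finset.finite_toSet _)).trans (Set.ncard_coe_finset T).le)
  rw [hdim] at h
  obtain ⟨m, hm⟩ : ∃ m : ℕ, ringKrullDim (S ⧸ Ideal.span (x '' T)) = m := by
    have := ringKrullDim_lt_top (R := S ⧸ Ideal.span (x '' T))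
    have h0 := ringKrullDim_nonneg_of_nontrivial (R := S ⧸ Ideal.span (x '' T))
    generalize ringKrullDim (S ⧸ Ideal.span (x '' T)) = D at *
    cases D with
    | bot => simp at h0
    | coe D =>
      cases D with
      | top => exact absurd this (lt_irrefl _)
      | coe D => exact ⟨D, rfl⟩
  rw [hm] at h ⊢
  norm_cast at h ⊢
  omega

/-- Killing `T` removes `T.card` generators of the maximal ideal and lowers the dimension by at most
`T.card`, so the embedding dimension is at most the dimension. -/
theorem isRegularLocalRing_quotient_span (T : Finset ι) :
    IsRegularLocalRing (S ⧸ Ideal.span (x '' T)) := by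
  have hmem : ∀ i, x i ∈ maximalIdeal S := fun i => hx ▸ Ideal.subset_span ⟨i, rfl⟩
  have hle : Ideal.span (x '' T) ≤ maximalIdeal S := by
    rw [Ideal.span_le]; rintro _ ⟨i, _, rfl⟩; exact hmem i
  have := isLocalRing_quotient_of_le _ hle
  apply IsRegularLocalRing.of_spanFinrank_maximalIdeal_le
  refine le_trans ?_ (card_le_ringKrullDim_quotient x hx hdim T)
  exact_mod_cast spanFinrank_maximalIdeal_quotient_le x hx _ T
    (fun i hi => Ideal.subset_span (Set.mem_image_of_mem x hi))

/-- Otherwise the quotient would have a maximal ideal generated by fewer elements than its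
dimension. -/
theorem notMem_span_of_notMem (T : Finset ι) (j : ι) (hj : j ∉ T) :
    x j ∉ Ideal.span (x '' T) := by
  intro hjT
  have := isRegularLocalRing_quotient_span x hx hdim T
  have h1 := spanFinrank_maximalIdeal_quotient_le x hx (Ideal.span (x '' T)) (insert j T)
    (fun i hi => by
      rcases Finset.mem_insert.mp hi with rfl | hi
      · exact hjT
      · exact Ideal.subset_span ⟨i, hi, rfl⟩)
  have h2 := card_le_ringKrullDim_quotient x hx hdim T
  rw [← IsRegularLocalRing.spanFinrank_maximalIdeal] at h2
  norm_cast at h2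
  rw [Finset.card_insert_of_notMem hj] at h1
  have h3 : (insert j T).card ≤ Fintype.card ι := Finset.card_le_univ _
  rw [Finset.card_insert_of_notMem hj] at h3
  omega

theorem ringKrullDim_quotient_span (T : Finset ι) :
    ringKrullDim (S ⧸ Ideal.span (x '' T)) = (Fintype.card ι - T.card : ℕ) := by
  have := isRegularLocalRing_quotient_span x hx hdim T
  refine le_antisymm ?_ (card_le_ringKrullDim_quotient x hx hdim T)
  rw [← IsRegularLocalRing.spanFinrank_maximalIdeal]
  exact_mod_cast spanFinrank_maximalIdeal_quotient_le x hx _ T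
    (fun i hi => Ideal.subset_span (Set.mem_image_of_mem x hi))

end

/-- An exchange argument: in terms of a minimal system of generators, some coefficient of `y` is a
unit since `y` is outside the square, so `y` can replace that generator. -/
theorem exists_parameters_of_mem [IsRegularLocalRing S] {n : ℕ} (hn : ringKrullDim S = (n + 1 : ℕ))
    (y : S) (hy : y ∈ maximalIdeal S) (hy2 : y ∉ maximalIdeal S ^ 2) :
    ∃ x : Fin (n + 1) → S, x 0 = y ∧ Ideal.span (Set.range x) = maximalIdeal S := by
  have hs : (maximalIdeal S).spanFinrank = n + 1 := by
    have := IsRegularLocalRing.spanFinrank_maximalIdeal (R := S)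
    rw [hn] at this
    exact_mod_cast this
  obtain ⟨s, hs1, hs2⟩ := Submodule.FG.exists_span_finset_card_eq_spanFinrank
    (maximalIdeal S).fg_of_isNoetherianRing
  rw [hs] at hs1
  let e : Fin (n + 1) ≃ s := (Finset.equivFinOfCardEq hs1).symm
  let w : Fin (n + 1) → S := fun i => e i
  have hw : Ideal.span (Set.range w) = maximalIdeal S := by
    rw [← hs2]
    congr 1
    ext t
    constructor
    · rintro ⟨i, rfl⟩; exact (e i).2
    · intro ht; exact ⟨e.symm ⟨t, ht⟩, by simp [w]⟩
  have hwm : ∀ i, w i ∈ maximalIdeal S := fun i => hw ▸ Ideal.subset_span ⟨i, rfl⟩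
  obtain ⟨c, hc⟩ := (Ideal.mem_span_range_iff_exists_fun).mp (hw.symm ▸ hy)
  obtain ⟨i, hi⟩ : ∃ i, IsUnit (c i) := by
    by_contra! hcon
    apply hy2
    rw [← hc, pow_two]
    exact Ideal.sum_mem _ fun i _ => Ideal.mul_mem_mul ((mem_maximalIdeal _).mpr (hcon i)) (hwm i)
  let x : Fin (n + 1) → S := Function.update (w ∘ Equiv.swap 0 i) 0 y
  refine ⟨x, by simp [x], le_antisymm ?_ ?_⟩
  · rw [Ideal.span_le]
    rintro _ ⟨j, rfl⟩
    by_cases hj : j = 0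
    · subst hj; simpa [x] using hy
    · simpa [x, hj] using hwm _
  · have hx0 : y ∈ Ideal.span (Set.range x) := Ideal.subset_span ⟨0, by simp [x]⟩
    have hxj : ∀ j, j ≠ i → w j ∈ Ideal.span (Set.range x) := by
      intro j hj
      refine Ideal.subset_span ⟨Equiv.swap 0 i j, ?_⟩
      have : Equiv.swap 0 i j ≠ 0 := by
        intro h
        apply hj
        rw [Equiv.swap_apply_eq_iff] at h
        simpa using h
      simp [x, this]
    rw [← hw, Ideal.span_le]
    rintro _ ⟨j, rfl⟩
    by_cases hj : j = i
    · subst hj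
      obtain ⟨u, hu⟩ := hi
      have : c j * w j = y - ∑ k ∈ Finset.univ.erase j, c k * w k := by
        rw [← hc, ← Finset.add_sum_erase _ _ (Finset.mem_univ j)]; ring
      have h2 : c j * w j ∈ Ideal.span (Set.range x) := by
        rw [this]
        exact Ideal.sub_mem _ hx0 (Ideal.sum_mem _ fun k hk =>
          Ideal.mul_mem_left _ _ (hxj k (Finset.ne_of_mem_erase hk)))
      rw [← hu] at h2
      exact (Ideal.unit_mul_mem_iff_mem _ u.isUnit).mp h2
    · exact hxj j hj

theorem isRegularLocalRing_quotient_span_singleton [IsRegularLocalRing S] {n : ℕ}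
    (hn : ringKrullDim S = (n + 1 : ℕ))
    (y : S) (hy : y ∈ maximalIdeal S) (hy2 : y ∉ maximalIdeal S ^ 2) :
    IsRegularLocalRing (S ⧸ Ideal.span {y}) ∧ ringKrullDim (S ⧸ Ideal.span {y}) = n := by
  obtain ⟨x, rfl, hx⟩ := exists_parameters_of_mem hn y hy hy2
  have h1 := isRegularLocalRing_quotient_span x hx (by simpa using hn) {0}
  have h2 := ringKrullDim_quotient_span x hx (by simpa using hn) {0}
  have hs : x '' (({0} : Finset (Fin (n + 1))) : Set (Fin (n + 1))) = {x 0} := by simp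
  rw [hs] at h1 h2
  exact ⟨h1, by simpa using h2⟩

/-- Choose `y ∈ 𝔫 \ 𝔫²` outside all minimal primes. By induction `(y)` is prime, so it contains a
minimal prime `P`; since `y ∉ P`, this forces `P = yP`, and Nakayama gives `P = 0`. -/
theorem isDomain_of_isRegularLocalRing_aux (n : ℕ) : ∀ (S : Type u) [CommRing S]
    [IsRegularLocalRing S], ringKrullDim S = n → IsDomain S := by
  induction n with
  | zero =>
    intro S _ _ hS
    have h := IsRegularLocalRing.spanFinrank_maximalIdeal (R := S)
    rw [hS] at h
    have h0 : maximalIdeal S = ⊥ :=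
      (Submodule.spanFinrank_eq_zero_iff_eq_bot
        (maximalIdeal S).fg_of_isNoetherianRing).mp (by exact_mod_cast h)
    have : (⊥ : Ideal S).IsPrime := h0 ▸ inferInstance
    exact IsDomain.of_bot_isPrime S
  | succ n ih =>
    intro S _ _ hS
    have hfin := minimalPrimes.finite_of_isNoetherianRing S
    obtain ⟨y, hy, hy2, hymin⟩ : ∃ y ∈ maximalIdeal S, y ∉ maximalIdeal S ^ 2 ∧
        ∀ P ∈ minimalPrimes S, y ∉ P := by
      by_contra! hcon
      have hsub : (maximalIdeal S : Set S) ⊆ ⋃ P ∈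
          ((insert (maximalIdeal S ^ 2) hfin.toFinset : Finset (Ideal S)) : Set (Ideal S)),
            ((id P : Ideal S) : Set S) := by
        intro y hy
        by_cases hy2 : y ∈ maximalIdeal S ^ 2
        · exact Set.mem_biUnion (by simp) hy2
        · obtain ⟨P, hP, hyP⟩ := hcon y hy hy2
          exact Set.mem_biUnion (by simp [hP]) hyP
      -- Prime avoidance tolerates two nonprime ideals; the square of the maximal ideal fills both
      -- places.
      rw [Ideal.subset_union_prime (maximalIdeal S ^ 2) (maximalIdeal S ^ 2)] at hsub
      · obtain ⟨P, hP, hle⟩ := hsub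
        have hdim : ringKrullDim S ≠ 0 := by rw [hS]; norm_cast
        rcases Finset.mem_insert.mp hP with rfl | hP
        · have hbot : maximalIdeal S = ⊥ := by
            apply Submodule.eq_bot_of_le_smul_of_le_jacobson_bot (maximalIdeal S) _
              (maximalIdeal S).fg_of_isNoetherianRing _ (maximalIdeal_le_jacobson _)
            rw [smul_eq_mul, ← pow_two]
            exact hle
          apply hdim
          rw [← IsRegularLocalRing.spanFinrank_maximalIdeal, hbot]
          simp
        · rw [Set.Finite.mem_toFinset] at hP
          have hPp : P.IsPrime := hP.1.1
          have : P = maximalIdeal S := le_antisymm (le_maximalIdeal hPp.ne_top) hle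
          subst this
          apply hdim
          rw [← maximalIdeal_height_eq_ringKrullDim, Ideal.height_eq_zero_iff.mpr hP]
          rfl
      · intro P hP h1 _
        rcases Finset.mem_insert.mp hP with rfl | hP
        · exact absurd rfl h1
        · rw [Set.Finite.mem_toFinset] at hP
          exact hP.1.1
    obtain ⟨hreg, hdim⟩ := isRegularLocalRing_quotient_span_singleton hS y hy hy2
    have hdom := ih (S ⧸ Ideal.span {y}) hdim
    have hprime : (Ideal.span {y}).IsPrime := (Ideal.Quotient.isDomain_iff_prime _).mp hdom
    obtain ⟨P, hP, hPy⟩ := Ideal.exists_minimalPrimes_le (bot_le (a := Ideal.span {y}))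
    have hPp : P.IsPrime := hP.1.1
    have hyP := hymin P hP
    have hbot : P = ⊥ := by
      apply Submodule.eq_bot_of_le_smul_of_le_jacobson_bot (maximalIdeal S) _
        P.fg_of_isNoetherianRing _ (maximalIdeal_le_jacobson _)
      intro p hp
      obtain ⟨a, rfl⟩ := Ideal.mem_span_singleton'.mp (hPy hp)
      rw [mul_comm, smul_eq_mul]
      exact Ideal.mul_mem_mul hy ((hPp.mem_or_mem hp).resolve_right hyP)
    have : (⊥ : Ideal S).IsPrime := hbot ▸ hPp
    exact IsDomain.of_bot_isPrime S

theorem exists_ringKrullDim_eq_natCast (S : Type*) [CommRing S] [IsLocalRing S]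
    [IsNoetherianRing S] : ∃ n : ℕ, ringKrullDim S = n := by
  have h1 := ringKrullDim_lt_top (R := S)
  have h0 := ringKrullDim_nonneg_of_nontrivial (R := S)
  generalize ringKrullDim S = D at *
  cases D with
  | bot => simp at h0
  | coe D =>
    cases D with
    | top => exact absurd h1 (lt_irrefl _)
    | coe D => exact ⟨D, rfl⟩

theorem isDomain_of_isRegularLocalRing (S : Type u) [CommRing S] [IsRegularLocalRing S] :
    IsDomain S := by
  obtain ⟨n, hn⟩ := exists_ringKrullDim_eq_natCast S
  exact isDomain_of_isRegularLocalRing_aux n S hn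

theorem exists_parameters (S : Type u) [CommRing S] [IsRegularLocalRing S] {n : ℕ}
    (hn : ringKrullDim S = n) :
    ∃ x : Fin n → S, Ideal.span (Set.range x) = maximalIdeal S := by
  have hs : (maximalIdeal S).spanFinrank = n := by
    have := IsRegularLocalRing.spanFinrank_maximalIdeal (R := S)
    rw [hn] at this
    exact_mod_cast this
  obtain ⟨s, hs1, hs2⟩ := Submodule.FG.exists_span_finset_card_eq_spanFinrank
    (maximalIdeal S).fg_of_isNoetherianRing
  rw [hs] at hs1
  let e : Fin n ≃ s := (Finset.equivFinOfCardEq hs1).symm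
  refine ⟨fun i => e i, ?_⟩
  rw [← hs2]
  congr 1
  ext t
  constructor
  · rintro ⟨i, rfl⟩; exact (e i).2
  · intro ht; exact ⟨e.symm ⟨t, ht⟩, by simp⟩

theorem mem_span_of_mul_mem [IsLocalRing S] [IsNoetherianRing S] {ι : Type*} [Fintype ι]
    [DecidableEq ι] (x : ι → S) (hx : Ideal.span (Set.range x) = maximalIdeal S)
    (hdim : ringKrullDim S = Fintype.card ι) (T : Finset ι) (j : ι) (hj : j ∉ T) (a : S)
    (ha : x j * a ∈ Ideal.span (x '' T)) : a ∈ Ideal.span (x '' T) := by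
  have := isRegularLocalRing_quotient_span x hx hdim T
  have hp : (Ideal.span (x '' T)).IsPrime := (Ideal.Quotient.isDomain_iff_prime _).mp
    (isDomain_of_isRegularLocalRing _)
  exact (hp.mem_or_mem ha).resolve_left (notMem_span_of_notMem x hx hdim T j hj)

end Parameters

end RegularLocal

/-! ### The Hilbert function of a regular local ring. -/

section HilbertFunction

/-- With `J` generated by the other parameters, `x 0 * a = x 0 * e + c` for some `e ∈ 𝔫^k` and `c ∈
J^(k+1)`. Since `x 0` is regular modulo `J^(k+1)`, the difference `a - e` lies in `J^(k+1)`. -/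
theorem mem_maximalIdeal_pow_of_mul_mem {S : Type u} [CommRing S] [IsLocalRing S]
    [IsNoetherianRing S] {n : ℕ} (x : Fin (n + 1) → S)
    (hx : Ideal.span (Set.range x) = maximalIdeal S) (hdim : ringKrullDim S = (n + 1 : ℕ))
    (k : ℕ) (a : S) (ha : x 0 * a ∈ maximalIdeal S ^ (k + 1)) : a ∈ maximalIdeal S ^ k := by
  set J := Ideal.span (x '' ((Finset.univ.erase 0 : Finset (Fin (n + 1))) : Set (Fin (n + 1))))
  have hm : maximalIdeal S = Ideal.span {x 0} ⊔ J := by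
    rw [← hx, ← Ideal.span_union, ← Set.image_singleton, ← Set.image_union, ← Set.image_univ]
    congr 2
    ext i
    simp
  have hJ : J ≤ maximalIdeal S := hm ▸ le_sup_right
  have h1 := Ideal.sup_pow_succ_le (Ideal.span {x 0}) J k (hm ▸ ha)
  rw [← hm] at h1
  obtain ⟨u, hu, c, hc, huc⟩ := Submodule.mem_sup.mp h1
  obtain ⟨e, he, rfl⟩ := Ideal.mem_span_singleton_mul.mp hu
  have h2 : a - e ∈ J ^ (k + 1) := by
    have := mem_sup_pow_of_mul_mem x (mem_span_of_mul_mem x hx (by simpa using hdim))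
      (Finset.univ.erase 0) ∅ (by simp) 0 (by simp) (by simp) (k + 1) (a - e) (by
        refine Ideal.mem_sup_right ?_
        have : x 0 * (a - e) = c := by linear_combination -huc
        rwa [this])
    rwa [Finset.coe_empty, Set.image_empty, Ideal.span_empty, bot_sup_eq] at this
  have h3 : a - e ∈ maximalIdeal S ^ k :=
    Ideal.pow_le_pow_right (Nat.le_succ k) (Ideal.pow_right_mono hJ _ h2)
  simpa using Ideal.add_mem _ h3 he

theorem length_quotient_maximalIdeal (S : Type*) [CommRing S] [IsLocalRing S] :
    Module.length S (S ⧸ maximalIdeal S) = 1 := by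
  have : IsSimpleModule S (S ⧸ maximalIdeal S) :=
    isSimpleModule_iff_quot_maximal.mpr ⟨_, inferInstance, ⟨LinearEquiv.refl _ _⟩⟩
  exact Module.length_eq_one S _

/-- The Hilbert-Samuel function of a regular local ring. -/
theorem length_quotient_maximalIdeal_pow (n : ℕ) : ∀ (S : Type u) [CommRing S]
    [IsRegularLocalRing S], ringKrullDim S = n → ∀ k : ℕ,
      Module.length S (S ⧸ maximalIdeal S ^ (k + 1)) = ((n + k).choose n : ℕ) := by
  induction n with
  | zero =>
    intro S _ _ hS k
    have h := IsRegularLocalRing.spanFinrank_maximalIdeal (R := S)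
    rw [hS] at h
    have h0 : maximalIdeal S = ⊥ :=
      (Submodule.spanFinrank_eq_zero_iff_eq_bot
        (maximalIdeal S).fg_of_isNoetherianRing).mp (by exact_mod_cast h)
    have h1 : maximalIdeal S ^ (k + 1) = maximalIdeal S := by
      rw [h0]; exact Ideal.bot_pow (Nat.succ_ne_zero k)
    rw [h1, length_quotient_maximalIdeal]
    simp
  | succ n ih =>
    intro S _ _ hS
    obtain ⟨x, hx⟩ := exists_parameters S hS
    have hs : x '' (({0} : Finset (Fin (n + 1))) : Set (Fin (n + 1))) = {x 0} := by simp
    have hreg := isRegularLocalRing_quotient_span x hx (by simpa using hS) {0}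
    have hdim := ringKrullDim_quotient_span x hx (by simpa using hS) {0}
    rw [hs] at hreg hdim
    set T := S ⧸ Ideal.span {x 0}
    have hmap : maximalIdeal T = (maximalIdeal S).map (Ideal.Quotient.mk _) :=
      (map_maximalIdeal_quotient _).symm
    have hT := ih T (by simpa using hdim)
    have hx0 : x 0 ∈ maximalIdeal S := hx ▸ Ideal.subset_span ⟨0, rfl⟩
    intro k
    induction k with
    | zero => rw [zero_add, pow_one, length_quotient_maximalIdeal]; simp
    | succ k ihk =>
      have hcomap : ∀ a : S, (Ideal.Quotient.mk _ a : T) ∈ maximalIdeal T ^ (k + 1 + 1) ↔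
          a ∈ Ideal.span {x 0} ⊔ maximalIdeal S ^ (k + 1 + 1) := by
        intro a
        rw [hmap, ← Ideal.map_pow, Ideal.mem_quotient_iff_mem_sup, sup_comm]
      -- Multiplication by `x 0` and reduction modulo `x 0` form a short exact sequence; additivity
      -- of length then turns the two inductions into Pascal's rule.
      let f : (S ⧸ maximalIdeal S ^ (k + 1)) →ₗ[S] (S ⧸ maximalIdeal S ^ (k + 1 + 1)) :=
        Submodule.mapQ _ _ (LinearMap.mulLeft S (x 0)) (fun a ha => by
          show x 0 * a ∈ maximalIdeal S ^ (k + 1 + 1)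
          rw [pow_succ' _ (k + 1)]
          exact Ideal.mul_mem_mul hx0 ha)
      let g : (S ⧸ maximalIdeal S ^ (k + 1 + 1)) →ₐ[S] (T ⧸ maximalIdeal T ^ (k + 1 + 1)) :=
        Ideal.quotientMapₐ _ (Ideal.Quotient.mkₐ S (Ideal.span {x 0})) (fun a ha =>
          (hcomap a).mpr (Ideal.mem_sup_right ha))
      have hlen := Module.length_eq_add_of_exact f g.toLinearMap (by
          rw [← LinearMap.ker_eq_bot, LinearMap.ker_eq_bot']
          intro a ha
          obtain ⟨a, rfl⟩ := Ideal.Quotient.mk_surjective a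
          have ha' : x 0 * a ∈ maximalIdeal S ^ (k + 1 + 1) := Ideal.Quotient.eq_zero_iff_mem.mp ha
          exact Ideal.Quotient.eq_zero_iff_mem.mpr
            (mem_maximalIdeal_pow_of_mul_mem x hx hS _ a ha'))
        (by
          intro b
          obtain ⟨b, rfl⟩ := Ideal.Quotient.mk_surjective b
          obtain ⟨a, rfl⟩ := Ideal.Quotient.mk_surjective b
          exact ⟨Ideal.Quotient.mk _ a, rfl⟩)
        (by
          intro b
          obtain ⟨b, rfl⟩ := Ideal.Quotient.mk_surjective b
          constructor
          · intro hb
            have hb' : (Ideal.Quotient.mk _ b : T) ∈ maximalIdeal T ^ (k + 1 + 1) :=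
              Ideal.Quotient.eq_zero_iff_mem.mp hb
            rw [hcomap] at hb'
            obtain ⟨u, hu, v, hv, rfl⟩ := Submodule.mem_sup.mp hb'
            obtain ⟨a, rfl⟩ := Ideal.mem_span_singleton'.mp hu
            refine ⟨Ideal.Quotient.mk _ a, ?_⟩
            refine (Ideal.Quotient.eq.mpr ?_ : Ideal.Quotient.mk (maximalIdeal S ^ (k + 1 + 1))
              (x 0 * a) = Ideal.Quotient.mk _ (a * x 0 + v))
            have : x 0 * a - (a * x 0 + v) = -v := by ring
            rw [this]
            exact neg_mem hv
          · rintro ⟨a, ha⟩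
            obtain ⟨a, rfl⟩ := Ideal.Quotient.mk_surjective a
            have ha' : Ideal.Quotient.mk (maximalIdeal S ^ (k + 1 + 1)) (x 0 * a) =
              Ideal.Quotient.mk _ b := ha
            rw [← ha']
            refine Ideal.Quotient.eq_zero_iff_mem.mpr ((hcomap _).mpr (Ideal.mem_sup_left ?_))
            exact Ideal.mul_mem_right _ _ (Ideal.mem_span_singleton_self _))
      rw [hlen, ihk, Module.length_eq_of_surjective (R := T) (S := S)
        Ideal.Quotient.mk_surjective, hT]
      norm_cast
      have e1 : n + 1 + (k + 1) = (n + 1 + k) + 1 := by ring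
      have e2 : n + (k + 1) = n + 1 + k := by ring
      rw [e1, e2, Nat.choose_succ_succ, add_comm]

end HilbertFunction

/-! ### Depth -/

section Depth

open RingTheory.Sequence

/-- Prime avoidance for a finite family in which one ideal `I` may fail to be prime. -/
theorem exists_mem_maximalIdeal_notMem {A : Type*} [CommRing A] [IsLocalRing A]
    (s : Set (Ideal A)) (hs : s.Finite) (I : Ideal A) (hp : ∀ P ∈ s, P ≠ I → P.IsPrime)
    (hn : ∀ P ∈ s, ¬ maximalIdeal A ≤ P) : ∃ w ∈ maximalIdeal A, ∀ P ∈ s, w ∉ P := by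
  by_contra! hcon
  have hsub : (maximalIdeal A : Set A) ⊆ ⋃ P ∈ (hs.toFinset : Set (Ideal A)),
      ((id P : Ideal A) : Set A) := by
    intro y hy
    obtain ⟨P, hP, hyP⟩ := hcon y hy
    exact Set.mem_biUnion (by simpa using hP) hyP
  obtain ⟨P, hP, hle⟩ := (Ideal.subset_union_prime (f := id) I I
    (fun P hP h _ => hp P (by simpa using hP) h)).mp hsub
  exact hn P (by simpa using hP) hle

variable {A : Type*} [CommRing A] [IsLocalRing A] [IsNoetherianRing A]

omit [IsLocalRing A] in
theorem isSMulRegular_of_forall_notMem {M : Type*} [AddCommGroup M] [Module A M] (w : A)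
    (h : ∀ P ∈ associatedPrimes A M, w ∉ P) : IsSMulRegular M w := by
  by_contra hw
  have : w ∈ ⋃ p ∈ associatedPrimes A M, (p : Set A) := by
    rw [biUnion_associatedPrimes_eq_compl_regular]; exact hw
  obtain ⟨P, hP, hwP⟩ := Set.mem_iUnion₂.mp this
  exact h P hP hwP

omit [IsLocalRing A] in
theorem notMem_of_isSMulRegular {M : Type*} [AddCommGroup M] [Module A M] {w : A}
    (hw : IsSMulRegular M w) {P : Ideal A} (hP : P ∈ associatedPrimes A M) : w ∉ P := by
  intro h
  have : w ∈ ⋃ p ∈ associatedPrimes A M, (p : Set A) := Set.mem_biUnion hP h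
  rw [biUnion_associatedPrimes_eq_compl_regular] at this
  exact this hw

omit [IsLocalRing A] [IsNoetherianRing A] in
/-- If `x` and `y` are regular on `M`, a nonzero element of `M / xM` killed by an ideal containing
both gives such an element of `M / yM`. -/
theorem exists_ne_zero_quotSMulTop_swap {M : Type*} [AddCommGroup M] [Module A M] {x y : A}
    (hx : IsSMulRegular M x) (hy : IsSMulRegular M y) (m : Ideal A) (hym : y ∈ m)
    (u : QuotSMulTop x M) (hu : u ≠ 0) (hmu : ∀ a ∈ m, a • u = 0) :
    ∃ v : QuotSMulTop y M, v ≠ 0 ∧ ∀ a ∈ m, a • v = 0 := by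
  have hmem : ∀ (t : A) (w : M), (Submodule.Quotient.mk w : QuotSMulTop t M) = 0 ↔
      ∃ w', w = t • w' := by
    intro t w
    rw [Submodule.Quotient.mk_eq_zero, Submodule.mem_smul_pointwise_iff_exists]
    simp [eq_comm]
  obtain ⟨u, rfl⟩ := Submodule.Quotient.mk_surjective _ u
  have hmu' : ∀ a ∈ m, ∃ w', a • u = x • w' := fun a ha => (hmem x _).mp (hmu a ha)
  obtain ⟨v, hv⟩ := hmu' y hym
  refine ⟨Submodule.Quotient.mk v, fun hv0 => hu ?_, fun a ha => ?_⟩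
  · obtain ⟨w, rfl⟩ := (hmem y v).mp hv0
    refine (hmem x u).mpr ⟨w, hy ?_⟩
    show y • u = y • x • w
    rw [hv, smul_comm]
  · obtain ⟨w, hw⟩ := hmu' a ha
    refine (hmem y _).mpr ⟨w, hx ?_⟩
    show x • a • v = x • y • w
    rw [smul_comm x a, ← hv, smul_comm a y, hw, smul_comm x y]

theorem mem_associatedPrimes_of_forall_smul_eq_zero {M : Type*} [AddCommGroup M] [Module A M]
    (u : M) (hu : u ≠ 0) (hmu : ∀ a ∈ maximalIdeal A, a • u = 0) :
    maximalIdeal A ∈ associatedPrimes A M := by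
  rw [AssociatedPrimes.mem_iff, isAssociatedPrime_iff]
  refine ⟨inferInstance, u, le_antisymm ?_ (le_maximalIdeal ?_)⟩
  · intro a ha
    simpa [Submodule.mem_colon_singleton] using hmu a ha
  · rw [Ne, Ideal.eq_top_iff_one]
    simpa [Submodule.mem_colon_singleton] using hu

omit [IsLocalRing A] in
theorem exists_of_mem_associatedPrimes {M : Type*} [AddCommGroup M] [Module A M] {P : Ideal A}
    (h : P ∈ associatedPrimes A M) : ∃ u : M, u ≠ 0 ∧ ∀ a ∈ P, a • u = 0 := by
  rw [AssociatedPrimes.mem_iff, isAssociatedPrime_iff] at h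
  obtain ⟨hP, u, rfl⟩ := h
  refine ⟨u, ?_, fun a ha => by simpa [Submodule.mem_colon_singleton] using ha⟩
  rintro rfl
  exact hP.ne_top (by simp)

/-- All maximal regular sequences have the same length: reducing modulo a regular element lowers
the depth by one at most. -/
theorem exists_isWeaklyRegular_quotSMulTop (n : ℕ) : ∀ (M : Type u) [AddCommGroup M] [Module A M]
    [Module.Finite A M] (rs : List A), rs.length = n + 1 → (∀ r ∈ rs, r ∈ maximalIdeal A) →
    IsWeaklyRegular M rs → ∀ x ∈ maximalIdeal A, IsSMulRegular M x →
    ∃ rs' : List A, rs'.length = n ∧ (∀ r ∈ rs', r ∈ maximalIdeal A) ∧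
      IsWeaklyRegular (QuotSMulTop x M) rs' := by
  induction n with
  | zero => exact fun M _ _ _ _ _ _ _ x _ _ => ⟨[], rfl, by simp, IsWeaklyRegular.nil _ _⟩
  | succ n ih =>
    intro M _ _ _ rs hlen hmem hreg x hxm hx
    obtain ⟨y, rs, rfl⟩ := List.exists_cons_of_length_eq_add_one hlen
    have hlen1 : rs.length = n + 1 := by simpa using hlen
    have hym : y ∈ maximalIdeal A := hmem y (by simp)
    have hmem1 : ∀ r ∈ rs, r ∈ maximalIdeal A := fun r hr => hmem r (by simp [hr])
    obtain ⟨hy, hreg1⟩ := (isWeaklyRegular_cons_iff M y rs).mp hreg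
    have hAy : ¬ maximalIdeal A ∈ associatedPrimes A (QuotSMulTop y M) := by
      intro hA
      obtain ⟨y2, rs2, rfl⟩ := List.exists_cons_of_length_eq_add_one hlen1
      obtain ⟨hy2, -⟩ := (isWeaklyRegular_cons_iff _ y2 rs2).mp hreg1
      exact notMem_of_isSMulRegular hy2 hA (hmem1 y2 (by simp))
    have hAx : ¬ maximalIdeal A ∈ associatedPrimes A (QuotSMulTop x M) := by
      intro hA
      obtain ⟨u, hu, hmu⟩ := exists_of_mem_associatedPrimes hA
      obtain ⟨v, hv, hmv⟩ := exists_ne_zero_quotSMulTop_swap hx hy _ hym u hu hmu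
      exact hAy (mem_associatedPrimes_of_forall_smul_eq_zero v hv hmv)
    -- An element `w` regular on both `M/yM` and `M/xM` mediates between `y` and `x`. Induction on
    -- `M/yM` with `w` gives a sequence `y, w, rs2` on `M`; permuted, it starts with `w`. Induction
    -- on `M/wM` with `x` then gives `w, x, rs3`, which is permuted to start with `x`.
    obtain ⟨w, hwm, hw⟩ := exists_mem_maximalIdeal_notMem
      (associatedPrimes A (QuotSMulTop y M) ∪ associatedPrimes A (QuotSMulTop x M))
      ((associatedPrimes.finite A _).union (associatedPrimes.finite A _)) ⊥
      (fun P hP _ => hP.elim (fun h => h.1) (fun h => h.1))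
      (fun P hP hle => by
        have hPp : P.IsPrime := hP.elim (fun h => h.1) (fun h => h.1)
        obtain rfl : P = maximalIdeal A := le_antisymm (le_maximalIdeal hPp.ne_top) hle
        exact hP.elim hAy hAx)
    have hwy : IsSMulRegular (QuotSMulTop y M) w :=
      isSMulRegular_of_forall_notMem w fun P hP => hw P (Or.inl hP)
    have hwx : IsSMulRegular (QuotSMulTop x M) w :=
      isSMulRegular_of_forall_notMem w fun P hP => hw P (Or.inr hP)
    obtain ⟨rs2, hl2, hm2, hr2⟩ := ih (QuotSMulTop y M) rs hlen1 hmem1 hreg1 w hwm hwy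
    have hMwy : IsWeaklyRegular M (w :: y :: rs2) :=
      isWeaklyRegular_of_perm_of_subset_maximalIdeal ((hr2.cons hwy).cons hy)
        (List.Perm.swap _ _ _) (by
          intro r hr
          simp only [List.mem_cons] at hr
          rcases hr with rfl | rfl | hr
          exacts [hym, hwm, hm2 r hr])
    obtain ⟨-, hMw⟩ := (isWeaklyRegular_cons_iff M w _).mp hMwy
    have hMwx : IsWeaklyRegular M [w, x] :=
      isWeaklyRegular_of_perm_of_subset_maximalIdeal
        (((IsWeaklyRegular.nil A _).cons hwx).cons hx) (List.Perm.swap _ _ _) (by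
          intro r hr
          simp only [List.mem_cons, List.not_mem_nil, or_false] at hr
          rcases hr with rfl | rfl
          exacts [hxm, hwm])
    obtain ⟨hw', hMx⟩ := (isWeaklyRegular_cons_iff M w _).mp hMwx
    obtain ⟨hx', -⟩ := (isWeaklyRegular_cons_iff _ x _).mp hMx
    obtain ⟨rs3, hl3, hm3, hr3⟩ := ih (QuotSMulTop w M) (y :: rs2) (by simp [hl2])
      (by
        intro r hr
        rcases List.mem_cons.mp hr with rfl | hr
        exacts [hym, hm2 r hr]) hMw x hxm hx'
    have hfin : IsWeaklyRegular M (x :: w :: rs3) :=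
      isWeaklyRegular_of_perm_of_subset_maximalIdeal ((hr3.cons hx').cons hw')
        (List.Perm.swap _ _ _) (by
          intro r hr
          simp only [List.mem_cons] at hr
          rcases hr with rfl | rfl | hr
          exacts [hwm, hxm, hm3 r hr])
    refine ⟨w :: rs3, by simp [hl3], ?_, ((isWeaklyRegular_cons_iff M x _).mp hfin).2⟩
    intro r hr
    rcases List.mem_cons.mp hr with rfl | hr
    exacts [hwm, hm3 r hr]

/-- Depth over a finite local extension can be computed with elements of the base. -/
theorem exists_isWeaklyRegular_map_algebraMap {S : Type*} [CommRing S] [IsLocalRing S]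
    [Algebra S A] [Module.Finite S A] [IsLocalHom (algebraMap S A)] (n : ℕ) :
    ∀ (M : Type u) [AddCommGroup M] [Module A M] [Module.Finite A M] (rs : List A),
    rs.length = n → (∀ r ∈ rs, r ∈ maximalIdeal A) → IsWeaklyRegular M rs →
    ∃ rs' : List S, rs'.length = n ∧ (∀ r ∈ rs', r ∈ maximalIdeal S) ∧
      IsWeaklyRegular M (rs'.map (algebraMap S A)) := by
  induction n with
  | zero => exact fun M _ _ _ _ _ _ _ => ⟨[], rfl, by simp, IsWeaklyRegular.nil _ _⟩
  | succ n ih =>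
    intro M _ _ _ rs hlen hmem hreg
    obtain ⟨y, rs1, rfl⟩ := List.exists_cons_of_length_eq_add_one hlen
    have hym : y ∈ maximalIdeal A := hmem y (by simp)
    obtain ⟨hy, -⟩ := (isWeaklyRegular_cons_iff M y rs1).mp hreg
    have hint : Algebra.IsIntegral S A := inferInstance
    -- An associated prime contracting to the maximal ideal of `S` would be maximal by integrality,
    -- hence contain the `M`-regular element `y`. So the contractions can be avoided inside the
    -- maximal ideal of `S`.
    obtain ⟨w, hwm, hw⟩ := exists_mem_maximalIdeal_notMem
      ((fun P => Ideal.comap (algebraMap S A) P) '' associatedPrimes A M)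
      ((associatedPrimes.finite A _).image _) ⊥
      (by
        rintro _ ⟨P, hP, rfl⟩ _
        have : P.IsPrime := hP.1
        exact Ideal.IsPrime.comap _)
      (by
        rintro _ ⟨P, hP, rfl⟩ hle
        have hPp : P.IsPrime := hP.1
        have hc : P.comap (algebraMap S A) = maximalIdeal S :=
          le_antisymm (le_maximalIdeal (Ideal.IsPrime.ne_top inferInstance)) hle
        have hcm : (P.comap (algebraMap S A)).IsMaximal := hc ▸ inferInstance
        have hPm : P.IsMaximal := Ideal.isMaximal_of_isIntegral_of_isMaximal_comap P hcm
        exact notMem_of_isSMulRegular hy hP (eq_maximalIdeal hPm ▸ hym))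
    have hw' : IsSMulRegular M (algebraMap S A w) :=
      isSMulRegular_of_forall_notMem _ fun P hP h => hw _ ⟨P, hP, rfl⟩ h
    have hwA : algebraMap S A w ∈ maximalIdeal A := by
      rw [mem_maximalIdeal] at hwm ⊢
      exact fun h => hwm (isUnit_of_map_unit _ _ h)
    obtain ⟨rs2, hl2, hm2, hr2⟩ :=
      exists_isWeaklyRegular_quotSMulTop n M _ hlen hmem hreg _ hwA hw'
    obtain ⟨rs3, hl3, hm3, hr3⟩ := ih (QuotSMulTop (algebraMap S A w) M) rs2 hl2 hm2 hr2
    refine ⟨w :: rs3, by simp [hl3], ?_, ?_⟩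
    · intro r hr
      rcases List.mem_cons.mp hr with rfl | hr
      exacts [hwm, hm3 r hr]
    · rw [List.map_cons]
      exact hr3.cons hw'

/-- A module of maximal depth over a regular local ring is free. -/
theorem free_of_isWeaklyRegular (n : ℕ) : ∀ (S : Type u) [CommRing S] [IsRegularLocalRing S]
    (_ : ringKrullDim S = n) (M : Type u) [AddCommGroup M] [Module S M] [Module.Finite S M]
    (rs : List S), rs.length = n → (∀ r ∈ rs, r ∈ maximalIdeal S) → IsWeaklyRegular M rs →
    Module.Free S M := by
  induction n with
  | zero =>
    intro S _ _ hS M _ _ _ _ _ _ _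
    have h := IsRegularLocalRing.spanFinrank_maximalIdeal (R := S)
    rw [hS] at h
    have h0 : maximalIdeal S = ⊥ :=
      (Submodule.spanFinrank_eq_zero_iff_eq_bot
        (maximalIdeal S).fg_of_isNoetherianRing).mp (by exact_mod_cast h)
    let : Field S := (isField_iff_maximalIdeal_eq.mpr h0).toField
    exact Module.Free.of_divisionRing S M
  | succ n ih =>
    intro S _ _ hS M _ _ _ rs hlen hmem hreg
    obtain ⟨y, rs1, rfl⟩ := List.exists_cons_of_length_eq_add_one hlen
    have hym : y ∈ maximalIdeal S := hmem y (by simp)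
    obtain ⟨hy, -⟩ := (isWeaklyRegular_cons_iff M y rs1).mp hreg
    -- Avoiding the associated primes makes `w` regular on `M`; avoiding the square keeps `S/(w)`
    -- regular. Freeness of `M/wM` over `S/(w)` then lifts to `M`.
    obtain ⟨w, hwm, hw⟩ := exists_mem_maximalIdeal_notMem
      (insert (maximalIdeal S ^ 2) (associatedPrimes S M))
      ((associatedPrimes.finite S _).insert _) (maximalIdeal S ^ 2)
      (fun P hP h => (hP.resolve_left h).1)
      (by
        rintro P (rfl | hP) hle
        · have hbot : maximalIdeal S = ⊥ := by
            apply Submodule.eq_bot_of_le_smul_of_le_jacobson_bot (maximalIdeal S) _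
              (maximalIdeal S).fg_of_isNoetherianRing _ (maximalIdeal_le_jacobson _)
            rw [smul_eq_mul, ← pow_two]
            exact hle
          have h := IsRegularLocalRing.spanFinrank_maximalIdeal (R := S)
          rw [hS, hbot] at h
          simp only [Submodule.spanFinrank_bot] at h
          norm_cast at h
        · exact notMem_of_isSMulRegular hy hP (hle hym))
    have hwr : IsSMulRegular M w := isSMulRegular_of_forall_notMem w fun P hP => hw P (Or.inr hP)
    obtain ⟨hreg', hdim⟩ := isRegularLocalRing_quotient_span_singleton hS w hwm
      (hw _ (Or.inl rfl))
    obtain ⟨rs2, hl2, hm2, hr2⟩ :=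
      exists_isWeaklyRegular_quotSMulTop n M _ hlen hmem hreg _ hwm hwr
    have hfin : Module.Finite (S ⧸ Ideal.span {w}) (QuotSMulTop w M) :=
      Module.Finite.of_restrictScalars_finite S _ _
    have hfree : Module.Free (S ⧸ Ideal.span {w}) (QuotSMulTop w M) := by
      refine ih (S ⧸ Ideal.span {w}) hdim (QuotSMulTop w M)
        (rs2.map (algebraMap S (S ⧸ Ideal.span {w}))) (by simpa using hl2) ?_
        ((isWeaklyRegular_map_algebraMap_iff _ _ rs2).mpr hr2)
      intro r hr
      obtain ⟨r, hr', rfl⟩ := List.mem_map.mp hr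
      rw [← map_maximalIdeal_quotient]
      exact Ideal.mem_map_of_mem _ (hm2 r hr')
    have : Module.FinitePresentation S M := Module.finitePresentation_of_finite S M
    exact (Module.free_quotSMulTop_iff_free S M (maximalIdeal_le_jacobson _ hwm) hwr).mp hfree

/-- A regular system of parameters is a regular sequence. -/
theorem exists_isWeaklyRegular_self (S : Type u) [CommRing S] [IsRegularLocalRing S] {n : ℕ}
    (hS : ringKrullDim S = n) : ∃ rs : List S, rs.length = n ∧ (∀ r ∈ rs, r ∈ maximalIdeal S) ∧
      IsWeaklyRegular S rs := by
  obtain ⟨x, hx⟩ := exists_parameters S hS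
  refine ⟨List.ofFn x, by simp, ?_, ⟨fun i hi => ?_⟩⟩
  · intro r hr
    obtain ⟨i, rfl⟩ := (List.mem_ofFn' _ _).mp hr
    exact hx ▸ Ideal.subset_span ⟨i, rfl⟩
  · rw [List.length_ofFn] at hi
    have hspan : (Ideal.ofList ((List.ofFn x).take i) • ⊤ : Ideal S) =
        Ideal.span (x '' ((Finset.univ.filter fun j : Fin n => j.1 < i : Finset (Fin n)) :
          Set (Fin n))) := by
      rw [smul_eq_mul, Ideal.mul_top]
      unfold Ideal.ofList
      congr 1
      ext r
      simp only [Set.mem_ofPred_eq, List.mem_take_iff_getElem, List.getElem_ofFn, Set.mem_image]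
      constructor
      · rintro ⟨j, hj, rfl⟩
        simp only [List.length_ofFn] at hj
        exact ⟨⟨j, by omega⟩, by simp; omega, rfl⟩
      · rintro ⟨j, hj, rfl⟩
        exact ⟨j, by simp at hj ⊢; omega, rfl⟩
    rw [isSMulRegular_quotient_iff_mem_of_smul_mem]
    intro a ha
    rw [hspan] at ha ⊢
    rw [List.getElem_ofFn] at ha
    exact mem_span_of_mul_mem x hx (by simpa using hS) _ ⟨i, hi⟩ (by simp) a ha

end Depth

/-! ### The branched cover as a finite extension -/

namespace BranchedCover

open RingTheory.Sequence

section Structure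

variable {S : Type u} [CommRing S] {d : ℕ} {f : S}

/-- The polynomial `X ^ d + f`. -/
noncomputable def poly (d : ℕ) (f : S) : Polynomial S := Polynomial.X ^ d + Polynomial.C f

theorem coe_poly (d : ℕ) (f : S) : (poly d f : S⟦X⟧) = C f + X ^ d := by
  simp [poly, add_comm]

theorem monic_poly (hd : d ≠ 0) : (poly d f).Monic := Polynomial.monic_X_pow_add_C f hd

variable [IsLocalRing S]

/-- The input to Weierstrass division, which replaces power series by polynomials. -/
theorem isDistinguishedAt_poly (hd : d ≠ 0) (hf : f ∈ maximalIdeal S) :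
    (poly d f).IsDistinguishedAt (maximalIdeal S) where
  monic := monic_poly hd
  mem {n} hn := by
    rw [poly, Polynomial.natDegree_X_pow_add_C] at hn
    rw [poly, Polynomial.coeff_add, Polynomial.coeff_X_pow, if_neg hn.ne, zero_add,
      Polynomial.coeff_C]
    split_ifs
    · exact hf
    · exact zero_mem _

variable [IsAdicComplete (maximalIdeal S) S]

/-- The branched cover is `S[X] / (X ^ d + f)`. -/
noncomputable def polyEquiv (hd : d ≠ 0) (hf : f ∈ maximalIdeal S) :
    (Polynomial S ⧸ Ideal.span {poly d f}) ≃ₐ[S] BranchedCover S d f :=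
  (isDistinguishedAt_poly hd hf).algEquivQuotient.trans
    (Ideal.quotientEquivAlgOfEq S (by rw [coe_poly]))

theorem polyEquiv_mk (hd : d ≠ 0) (hf : f ∈ maximalIdeal S) (p : Polynomial S) :
    polyEquiv hd hf (Ideal.Quotient.mk _ p) = Ideal.Quotient.mk _ (p : S⟦X⟧) := rfl

theorem polyEquiv_X (hd : d ≠ 0) (hf : f ∈ maximalIdeal S) :
    polyEquiv hd hf (Ideal.Quotient.mk _ Polynomial.X) = z S d f := by
  rw [polyEquiv_mk, Polynomial.coe_X]; rfl

theorem module_finite (hd : d ≠ 0) (hf : f ∈ maximalIdeal S) :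
    Module.Finite S (BranchedCover S d f) := by
  have := (monic_poly (f := f) hd).finite_quotient
  exact Module.Finite.equiv (polyEquiv hd hf).toLinearEquiv

theorem module_free (hd : d ≠ 0) (hf : f ∈ maximalIdeal S) :
    Module.Free S (BranchedCover S d f) := by
  have := (monic_poly (f := f) hd).free_quotient
  exact Module.Free.of_equiv (polyEquiv hd hf).toLinearEquiv

theorem exists_aeval_eq (hd : d ≠ 0) (hf : f ∈ maximalIdeal S) (r : BranchedCover S d f) :
    ∃ p : Polynomial S, Polynomial.aeval (z S d f) p = r := by
  obtain ⟨q, rfl⟩ := (polyEquiv hd hf).surjective r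
  obtain ⟨p, rfl⟩ := Ideal.Quotient.mk_surjective q
  refine ⟨p, ?_⟩
  rw [← polyEquiv_X hd hf, Polynomial.aeval_algHom_apply]
  congr 1
  exact (Polynomial.aeval_algHom_apply (Ideal.Quotient.mkₐ S (Ideal.span {poly d f}))
    Polynomial.X p).trans (by simp)

/-- The action of the branched cover on a module given by the action of `z`. -/
noncomputable def endHom (hd : d ≠ 0) (hf : f ∈ maximalIdeal S) {V : Type*} [AddCommGroup V]
    [Module S V] (t : Module.End S V) (ht : t ^ d = -algebraMap S _ f) :
    BranchedCover S d f →ₐ[S] Module.End S V :=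
  (Ideal.Quotient.liftₐ (Ideal.span {poly d f}) (Polynomial.aeval t) (by
    intro a ha
    obtain ⟨b, rfl⟩ := Ideal.mem_span_singleton'.mp ha
    rw [map_mul]
    simp [poly, ht])).comp (polyEquiv hd hf).symm.toAlgHom

theorem endHom_z (hd : d ≠ 0) (hf : f ∈ maximalIdeal S) {V : Type*} [AddCommGroup V]
    [Module S V] (t : Module.End S V) (ht : t ^ d = -algebraMap S _ f) :
    endHom hd hf t ht (z S d f) = t := by
  have : (polyEquiv hd hf).symm (z S d f) = Ideal.Quotient.mk _ Polynomial.X := by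
    rw [AlgEquiv.symm_apply_eq, polyEquiv_X]
  rw [endHom, AlgHom.comp_apply]
  refine (congrArg _ this).trans ?_
  exact Polynomial.aeval_X t

theorem map_smul_of_map_z_smul (hd : d ≠ 0) (hf : f ∈ maximalIdeal S) {V W : Type*}
    [AddCommGroup V] [AddCommGroup W] [Module S V] [Module S W]
    [Module (BranchedCover S d f) V] [Module (BranchedCover S d f) W]
    [IsScalarTower S (BranchedCover S d f) V] [IsScalarTower S (BranchedCover S d f) W]
    (φ : V →ₗ[S] W) (h : ∀ v, φ (z S d f • v) = z S d f • φ v) (r : BranchedCover S d f) (v : V) :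
    φ (r • v) = r • φ v := by
  obtain ⟨p, rfl⟩ := exists_aeval_eq hd hf r
  induction p using Polynomial.induction_on generalizing v with
  | C a => simp
  | add p q hp hq => simp only [map_add, add_smul, hp, hq]
  | monomial n a ih =>
    rw [pow_succ, ← mul_assoc, map_mul, Polynomial.aeval_X, mul_smul, ih, h, mul_smul]

/-- An `S`-linear map commuting with `z` is linear over the branched cover. -/
noncomputable def linearMapOfMapZSMul (hd : d ≠ 0) (hf : f ∈ maximalIdeal S) {V W : Type*}
    [AddCommGroup V] [AddCommGroup W] [Module S V] [Module S W]
    [Module (BranchedCover S d f) V] [Module (BranchedCover S d f) W]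
    [IsScalarTower S (BranchedCover S d f) V] [IsScalarTower S (BranchedCover S d f) W]
    (φ : V →ₗ[S] W) (h : ∀ v, φ (z S d f • v) = z S d f • φ v) :
    V →ₗ[BranchedCover S d f] W where
  toFun := φ
  map_add' := map_add φ
  map_smul' := map_smul_of_map_z_smul hd hf φ h

omit [IsAdicComplete (maximalIdeal S) S]

theorem mk_mem_maximalIdeal_iff [IsLocalRing (BranchedCover S d f)] (p : S⟦X⟧) :
    (Ideal.Quotient.mk _ p : BranchedCover S d f) ∈ maximalIdeal (BranchedCover S d f) ↔
      constantCoeff p ∈ maximalIdeal S := by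
  have : IsLocalHom (Ideal.Quotient.mk (Ideal.span {(C f + X ^ d : S⟦X⟧)})) :=
    IsLocalHom.of_surjective _ Ideal.Quotient.mk_surjective
  rw [mem_maximalIdeal, mem_maximalIdeal, mem_nonunits_iff, mem_nonunits_iff,
    isUnit_map_iff, PowerSeries.isUnit_iff_constantCoeff]

theorem maximalIdeal_eq [IsLocalRing (BranchedCover S d f)] :
    maximalIdeal (BranchedCover S d f) =
      (maximalIdeal S).map (algebraMap S (BranchedCover S d f)) ⊔ Ideal.span {z S d f} := by
  apply le_antisymm
  · intro r hr
    obtain ⟨p, rfl⟩ := Ideal.Quotient.mk_surjective r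
    rw [mk_mem_maximalIdeal_iff] at hr
    rw [PowerSeries.eq_X_mul_shift_add_const p, map_add, map_mul]
    refine Ideal.add_mem _ (Ideal.mem_sup_right ?_) (Ideal.mem_sup_left ?_)
    · exact Ideal.mul_mem_right _ _ (Ideal.mem_span_singleton_self _)
    · exact Ideal.mem_map_of_mem (algebraMap S (BranchedCover S d f)) hr
  · refine sup_le (Ideal.map_le_iff_le_comap.mpr fun a ha => ?_)
      ((Ideal.span_singleton_le_iff_mem _).mpr ?_)
    · refine (mk_mem_maximalIdeal_iff (C a)).mpr ?_
      simpa using ha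
    · refine (mk_mem_maximalIdeal_iff X).mpr ?_
      simp

theorem isLocalHom_algebraMap [IsLocalRing (BranchedCover S d f)] :
    IsLocalHom (algebraMap S (BranchedCover S d f)) := by
  refine ((local_hom_TFAE _).out 0 2).mpr ?_
  rw [maximalIdeal_eq]
  exact le_sup_left

/-- The residue fields coincide, because a power series differs from its constant coefficient by an
element of the maximal ideal. -/
theorem length_restrictScalars [IsLocalRing (BranchedCover S d f)] (M : Type*) [AddCommGroup M]
    [Module S M] [Module (BranchedCover S d f) M] [IsScalarTower S (BranchedCover S d f) M] :
    Module.length S M = Module.length (BranchedCover S d f) M := by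
  have := isLocalHom_algebraMap (S := S) (d := d) (f := f)
  rw [IsLocalRing.length_restrictScalars S (BranchedCover S d f) M]
  have hsurj : Function.Surjective (algebraMap (ResidueField S)
      (ResidueField (BranchedCover S d f))) := by
    intro b
    obtain ⟨r, rfl⟩ := residue_surjective b
    obtain ⟨p, rfl⟩ := Ideal.Quotient.mk_surjective r
    refine ⟨residue S (constantCoeff p), ?_⟩
    refine (Ideal.Quotient.eq.mpr ?_ : residue (BranchedCover S d f)
      (Ideal.Quotient.mk _ (C (constantCoeff p))) = residue _ (Ideal.Quotient.mk _ p))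
    rw [← map_sub, mk_mem_maximalIdeal_iff]
    simp
  rw [Module.length_eq_of_surjective hsurj,
    Module.length_eq_one (ResidueField (BranchedCover S d f)) (ResidueField (BranchedCover S d f)),
    mul_one]

end Structure

section MCM

variable {S : Type u} [CommRing S] [IsRegularLocalRing S] [IsAdicComplete (maximalIdeal S) S]
  {d : ℕ} {f : S} (hd : d ≠ 0) (hf : f ∈ maximalIdeal S) [IsLocalRing (BranchedCover S d f)]
include hd hf

omit [IsLocalRing (BranchedCover S d f)] in
theorem isNoetherianRing : IsNoetherianRing (BranchedCover S d f) := by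
  have := module_finite hd hf
  exact IsNoetherianRing.of_finite S _

omit [IsAdicComplete (maximalIdeal S) S] hd hf in
-- A regular system of parameters of `S` stays weakly regular on the flat `S`-module `N`.
theorem exists_isWeaklyRegular {n : ℕ} (hS : ringKrullDim S = n) (N : Type*) [AddCommGroup N]
    [Module S N] [Module (BranchedCover S d f) N] [IsScalarTower S (BranchedCover S d f) N]
    [Module.Free S N] : ∃ rs : List (BranchedCover S d f), rs.length = n ∧
      (∀ r ∈ rs, r ∈ maximalIdeal (BranchedCover S d f)) ∧ IsWeaklyRegular N rs := by
  obtain ⟨rs, hl, hm, hr⟩ := exists_isWeaklyRegular_self S hS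
  refine ⟨rs.map (algebraMap S _), by simpa using hl, ?_, ?_⟩
  · intro r hr
    obtain ⟨a, ha, rfl⟩ := List.mem_map.mp hr
    rw [maximalIdeal_eq]
    exact Ideal.mem_sup_left (Ideal.mem_map_of_mem _ (hm a ha))
  · rw [isWeaklyRegular_map_algebraMap_iff]
    exact ((TensorProduct.rid S N).isWeaklyRegular_congr rs).mp (hr.isWeaklyRegular_lTensor (M₂ := N))

/-- The upper bound is incomparability for integral extensions; the lower bound comes from a regular
sequence of length `dim S` on the ring itself. -/
theorem ringKrullDim_eq : ringKrullDim (BranchedCover S d f) = ringKrullDim S := by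
  have hfin := module_finite hd hf
  have hfree := module_free hd hf
  have hnoeth := isNoetherianRing hd hf
  have hint : Algebra.IsIntegral S (BranchedCover S d f) := inferInstance
  obtain ⟨n, hn⟩ := exists_ringKrullDim_eq_natCast S
  apply le_antisymm
  · refine Order.krullDim_le_of_strictMono
      (PrimeSpectrum.comap (algebraMap S (BranchedCover S d f))) ?_
    intro P Q hPQ
    exact Ideal.IsIntegral.comap_lt_comap (R := S) (I := P.asIdeal) (J := Q.asIdeal) hPQ
  · rw [hn]
    obtain ⟨rs, hl, hm, hr⟩ := exists_isWeaklyRegular (d := d) (f := f) hn (BranchedCover S d f)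
    have hreg := IsRegular.of_isWeaklyRegular_of_mem_maximalIdeal _ hm hr
    have := ringKrullDim_add_length_eq_ringKrullDim_of_isRegular rs hreg
    rw [← this, hl]
    have hnt : Nontrivial (BranchedCover S d f ⧸ Ideal.ofList rs) := by
      apply Ideal.Quotient.nontrivial_iff.mpr
      refine ne_top_of_le_ne_top (Ideal.IsPrime.ne_top
        (inferInstance : (maximalIdeal (BranchedCover S d f)).IsPrime)) (Ideal.span_le.mpr hm)
    exact le_add_of_nonneg_left ringKrullDim_nonneg_of_nontrivial

omit [IsRegularLocalRing S] [IsAdicComplete (maximalIdeal S) S] hd hf in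
theorem length_le_of_isRegular [IsNoetherianRing (BranchedCover S d f)] {n : ℕ}
    (hn : ringKrullDim (BranchedCover S d f) = n) (N : Type*) [AddCommGroup N]
    [Module (BranchedCover S d f) N] [Module.Finite (BranchedCover S d f) N]
    (rs : List (BranchedCover S d f)) (h : IsRegular N rs) : rs.length ≤ n := by
  have h1 := Module.supportDim_add_length_eq_supportDim_of_isRegular rs h
  have h2 := Module.supportDim_le_ringKrullDim (BranchedCover S d f) N
  have : Nontrivial (N ⧸ Ideal.ofList rs • (⊤ : Submodule (BranchedCover S d f) N)) :=
    h.quot_ofList_smul_nontrivial ⊤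
  have h3 : (0 : WithBot ℕ∞) ≤ Module.supportDim (BranchedCover S d f)
      (N ⧸ Ideal.ofList rs • (⊤ : Submodule (BranchedCover S d f) N)) := by
    have : Nonempty (Module.support (BranchedCover S d f)
      (N ⧸ Ideal.ofList rs • (⊤ : Submodule (BranchedCover S d f) N))) :=
      Module.nonempty_support_of_nontrivial.to_subtype
    exact Order.krullDim_nonneg
  rw [← h1, hn] at h2
  have h4 : (rs.length : WithBot ℕ∞) ≤ n := (le_add_of_nonneg_left h3).trans h2
  exact_mod_cast h4

theorem isMCM_of_free (N : Type*) [AddCommGroup N] [Module S N] [Module (BranchedCover S d f) N]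
    [IsScalarTower S (BranchedCover S d f) N] [Module.Free S N] [Module.Finite S N] :
    IsMCM (BranchedCover S d f) N := by
  have hnoeth := isNoetherianRing hd hf
  have hfin : Module.Finite (BranchedCover S d f) N := Module.Finite.of_restrictScalars_finite S _ _
  refine ⟨hfin, ?_⟩
  rcases subsingleton_or_nontrivial N with hN | hN
  · exact Or.inl hN
  right
  obtain ⟨n, hn⟩ := exists_ringKrullDim_eq_natCast S
  have hn' := (ringKrullDim_eq (S := S) hd hf).trans hn
  obtain ⟨rs, hl, hm, hr⟩ := exists_isWeaklyRegular (d := d) (f := f) hn N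
  have hreg := IsRegular.of_isWeaklyRegular_of_mem_maximalIdeal _ hm hr
  have : moduleDepth (BranchedCover S d f) N = n := by
    apply le_antisymm
    · refine iSup₂_le fun rs hrs => ?_
      exact_mod_cast length_le_of_isRegular hn' N rs hrs.2
    · rw [← hl]
      exact le_iSup₂_of_le (f := fun (rs : List (BranchedCover S d f))
        (_ : (∀ r ∈ rs, r ∈ maximalIdeal _) ∧ IsRegular N rs) => (rs.length : ℕ∞))
        rs ⟨hm, hreg⟩ le_rfl
  rw [this, hn']
  rfl

theorem free_and_finite_of_isMCM (N : Type u) [AddCommGroup N] [Module S N]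
    [Module (BranchedCover S d f) N] [IsScalarTower S (BranchedCover S d f) N]
    (h : IsMCM (BranchedCover S d f) N) : Module.Free S N ∧ Module.Finite S N := by
  have hnoeth := isNoetherianRing hd hf
  have hfinR := module_finite hd hf
  have hfin := h.1
  have hfinS : Module.Finite S N := Module.Finite.trans (BranchedCover S d f) N
  refine ⟨?_, hfinS⟩
  rcases h.2 with hs | hdepth
  · infer_instance
  obtain ⟨n, hn⟩ := exists_ringKrullDim_eq_natCast S
  have hn' := (ringKrullDim_eq (S := S) hd hf).trans hn
  rw [hn'] at hdepth
  have hdepth' : moduleDepth (BranchedCover S d f) N = n := by exact_mod_cast hdepth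
  -- The supremum defining the depth is attained: otherwise all lengths would be at most `n - 1`.
  -- The case `n = 0` is separate because the subtraction truncates.
  obtain ⟨rs, hl, hm, hr⟩ : ∃ rs : List (BranchedCover S d f), rs.length = n ∧
      (∀ r ∈ rs, r ∈ maximalIdeal (BranchedCover S d f)) ∧ IsWeaklyRegular N rs := by
    rcases Nat.eq_zero_or_pos n with rfl | hpos
    · exact ⟨[], rfl, by simp, IsWeaklyRegular.nil _ _⟩
    · by_contra! hcon
      have : moduleDepth (BranchedCover S d f) N ≤ (n - 1 : ℕ) := by
        refine iSup₂_le fun rs hrs => ?_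
        have h1 := length_le_of_isRegular hn' N rs hrs.2
        have h2 : rs.length ≠ n := fun h => hcon rs h hrs.1 hrs.2.toIsWeaklyRegular
        exact_mod_cast (by omega : rs.length ≤ n - 1)
      rw [hdepth'] at this
      have : n ≤ n - 1 := by exact_mod_cast this
      omega
  have := isLocalHom_algebraMap (S := S) (d := d) (f := f)
  obtain ⟨rs', hl', hm', hr'⟩ := exists_isWeaklyRegular_map_algebraMap (S := S) n N rs hl hm hr
  exact free_of_isWeaklyRegular n S hn N rs' hl' hm'
    ((isWeaklyRegular_map_algebraMap_iff _ _ rs').mp hr')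

end MCM

end BranchedCover

/-! ### Multiplicity and the Ulrich condition. -/

theorem mem_maximalIdeal_pow_of_le_maxIdealOrder {A : Type*} [CommRing A] [IsLocalRing A] {a : A}
    {d : ℕ} (h : (d : ℕ∞) ≤ maxIdealOrder A a) : a ∈ maximalIdeal A ^ d := by
  by_contra hcon
  have : maxIdealOrder A a ≤ (d - 1 : ℕ) := by
    refine iSup₂_le fun e he => ?_
    have : e < d := by
      by_contra! hlt
      exact hcon (Ideal.pow_le_pow_right hlt he)
    exact_mod_cast (by omega : e ≤ d - 1)
  have h1 : d ≤ d - 1 := by exact_mod_cast h.trans this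
  have : d = 0 := by omega
  subst this
  simp at hcon

theorem length_quotient_smul_top (S : Type*) [CommRing S] [IsLocalRing S] (N : Type*)
    [AddCommGroup N] [Module S N] [Module.Free S N] [Module.Finite S N] (I : Ideal S) :
    Module.length S (N ⧸ I • (⊤ : Submodule S N)) = Module.finrank S N * Module.length S (S ⧸ I) := by
  classical
  rw [← (TensorProduct.quotTensorEquivQuotSMul N I).length_eq,
    (TensorProduct.equivFinsuppOfBasisRight (M := S ⧸ I)
      (Module.finBasis S N)).length_eq, Module.length_finsupp]
  simp

theorem spanFinrank_top_eq_length {A : Type*} [CommRing A] [IsLocalRing A] (N : Type*)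
    [AddCommGroup N] [Module A N] [Module.Finite A N] :
    ((⊤ : Submodule A N).spanFinrank : ℕ∞) =
      Module.length A (N ⧸ maximalIdeal A • (⊤ : Submodule A N)) := by
  have hfg : (⊤ : Submodule A N).FG := Module.Finite.fg_top
  rw [spanFinrank_eq_finrank_quotient ⊤ hfg]
  have : Module.Finite A (⊤ : Submodule A N) := Module.Finite.iff_fg.mpr hfg
  have : Module.Finite (A ⧸ maximalIdeal A)
      ((⊤ : Submodule A N) ⧸ maximalIdeal A • (⊤ : Submodule A (⊤ : Submodule A N))) :=
    Module.Finite.of_restrictScalars_finite A _ _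
  have hlen := @Module.length_eq_finrank (A ⧸ maximalIdeal A)
    ((⊤ : Submodule A N) ⧸ maximalIdeal A • (⊤ : Submodule A (⊤ : Submodule A N)))
    (Ideal.Quotient.field _).toDivisionRing _ _ _
  refine hlen.symm.trans ?_
  refine (Module.length_eq_of_surjective (S := A) (R := A ⧸ maximalIdeal A)
    Ideal.Quotient.mk_surjective).symm.trans ?_
  refine (Submodule.Quotient.equiv _ _ Submodule.topEquiv ?_).length_eq
  rw [Submodule.map_smul'']
  simp

theorem tendsto_add_div_pow (c : ℝ) (n : ℕ) :
    Filter.Tendsto (fun k : ℕ => ((k : ℝ) + c) ^ n / (k : ℝ) ^ n) Filter.atTop (nhds 1) := by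
  have h : Filter.Tendsto (fun k : ℕ => (1 + c / (k : ℝ)) ^ n) Filter.atTop (nhds 1) := by
    have := ((tendsto_const_div_atTop_nhds_zero_nat c).const_add 1).pow n
    simpa using this
  refine h.congr' ?_
  filter_upwards [Filter.eventually_ne_atTop 0] with k hk
  have : (k : ℝ) ≠ 0 := by exact_mod_cast hk
  rw [← div_pow, add_div, div_self this]

namespace BranchedCover

section Ulrich

variable {S : Type u} [CommRing S] [IsLocalRing S]
  {d : ℕ} {f : S} [IsLocalRing (BranchedCover S d f)]

/-- This is where the order of `f` matters. A product of `d` elements of 𝔪 = 𝔫`R♯` + (`z`) either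
has a factor from 𝔫 or is a multiple of `z^d = -f`, which lies in 𝔫^d `R♯`. -/
theorem maximalIdeal_pow_le (hd : d ≠ 0) (hf : f ∈ maximalIdeal S ^ d) :
    maximalIdeal (BranchedCover S d f) ^ d ≤
      (maximalIdeal S).map (algebraMap S (BranchedCover S d f)) *
        maximalIdeal (BranchedCover S d f) ^ (d - 1) := by
  obtain ⟨e, rfl⟩ : ∃ e, d = e + 1 := Nat.exists_eq_succ_of_ne_zero hd
  have hz : z S (e + 1) f ^ (e + 1) ∈
      (maximalIdeal S).map (algebraMap S (BranchedCover S (e + 1) f)) ^ (e + 1) := by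
    rw [z_pow, ← Ideal.map_pow]
    exact neg_mem (Ideal.mem_map_of_mem _ hf)
  rw [Nat.add_sub_cancel]
  conv_lhs => rw [maximalIdeal_eq]
  refine (Ideal.sup_pow_succ_le _ _ e).trans ?_
  rw [← maximalIdeal_eq]
  refine sup_le le_rfl ?_
  rw [Ideal.span_singleton_pow, Ideal.span_singleton_le_iff_mem]
  have hz' := (pow_succ' ((maximalIdeal S).map (algebraMap S (BranchedCover S (e + 1) f))) e) ▸ hz
  refine Ideal.mul_mono_right (Ideal.pow_right_mono ?_ _) hz'
  rw [maximalIdeal_eq]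
  exact le_sup_left

theorem maximalIdeal_pow_add_le (hd : d ≠ 0) (hf : f ∈ maximalIdeal S ^ d) (k : ℕ) :
    maximalIdeal (BranchedCover S d f) ^ (d - 1 + k) ≤
      (maximalIdeal S ^ k).map (algebraMap S (BranchedCover S d f)) := by
  rw [Ideal.map_pow]
  induction k with
  | zero => simp
  | succ k ih =>
    rw [show d - 1 + (k + 1) = d + k by omega, pow_add, pow_succ']
    refine (Ideal.mul_mono_left (maximalIdeal_pow_le hd hf)).trans ?_
    rw [mul_assoc, ← pow_add]
    exact Ideal.mul_mono_right ih

variable (N : Type*) [AddCommGroup N] [Module S N] [Module (BranchedCover S d f) N]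
    [IsScalarTower S (BranchedCover S d f) N]

theorem length_quotient_map_smul_top (I : Ideal S) :
    Module.length (BranchedCover S d f)
      (N ⧸ I.map (algebraMap S (BranchedCover S d f)) • (⊤ : Submodule (BranchedCover S d f) N)) =
      Module.length S (N ⧸ I • (⊤ : Submodule S N)) := by
  rw [← length_restrictScalars (S := S),
    ← (Submodule.Quotient.restrictScalarsEquiv S _).length_eq, Ideal.smul_restrictScalars,
    Submodule.restrictScalars_top]

end Ulrich

section

variable {S : Type u} [CommRing S] [IsRegularLocalRing S] [IsAdicComplete (maximalIdeal S) S]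
  {d : ℕ} {f : S} [IsLocalRing (BranchedCover S d f)]
  (N : Type u) [AddCommGroup N] [Module S N] [Module (BranchedCover S d f) N]
    [IsScalarTower S (BranchedCover S d f) N] [Module.Free S N] [Module.Finite S N]

/-- The inclusions of 𝔫^k `R♯` in 𝔪^k and of 𝔪^(d-1+k) in 𝔫^k `R♯` squeeze the Hilbert-Samuel
function of `N` between shifts of the rank times a binomial coefficient. -/
theorem hasMultiplicity_finrank (hd : d ≠ 0) (hf : f ∈ maximalIdeal S ^ d) :
    HasMultiplicity (BranchedCover S d f) N (Module.finrank S N) := by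
  have hf1 : f ∈ maximalIdeal S := Ideal.pow_le_self hd hf
  obtain ⟨n, hn⟩ := exists_ringKrullDim_eq_natCast S
  refine ⟨n, (ringKrullDim_eq (S := S) hd hf1).trans hn, ?_⟩
  have hlen (k : ℕ) : Module.length (BranchedCover S d f)
      (N ⧸ (maximalIdeal S ^ (k + 1)).map (algebraMap S (BranchedCover S d f)) •
        (⊤ : Submodule (BranchedCover S d f) N)) =
      ((Module.finrank S N * (n + k).choose n : ℕ) : ℕ∞) := by
    rw [length_quotient_map_smul_top, length_quotient_smul_top, length_quotient_maximalIdeal_pow n S hn]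
    push_cast
    rfl
  set r := Module.finrank S N
  set L : ℕ → ℕ∞ := fun k => Module.length (BranchedCover S d f)
    (N ⧸ maximalIdeal (BranchedCover S d f) ^ k • (⊤ : Submodule (BranchedCover S d f) N))
  have hup (k : ℕ) : L (k + 1) ≤ ((r * (n + k).choose n : ℕ) : ℕ∞) := by
    rw [← hlen]
    refine Module.length_le_of_surjective (Submodule.factor (Submodule.smul_mono_left ?_))
      (Submodule.factor_surjective _)
    rw [Ideal.map_pow]
    refine Ideal.pow_right_mono ?_ _
    rw [maximalIdeal_eq]
    exact le_sup_left
  have hlow (k : ℕ) : ((r * (n + k).choose n : ℕ) : ℕ∞) ≤ L (d - 1 + (k + 1)) := by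
    rw [← hlen]
    exact Module.length_le_of_surjective
      (Submodule.factor (Submodule.smul_mono_left (maximalIdeal_pow_add_le hd hf (k + 1))))
      (Submodule.factor_surjective _)
  have hfin (k : ℕ) : L (k + 1) ≠ ⊤ := ne_top_of_le_ne_top (ENat.natCast_ne_top _) (hup k)
  -- With `r` the rank, the bounds on `n!` times the length are `r (k - (d - 1))^n` and `r (k +
  -- n)^n`; they come from comparing the falling factorial of `n + j` with powers.
  have h1 := (tendsto_add_div_pow (-(d - 1 : ℕ)) n).const_mul (r : ℝ)
  have h2 := (tendsto_add_div_pow n n).const_mul (r : ℝ)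
  rw [mul_one] at h1 h2
  refine tendsto_of_tendsto_of_tendsto_of_le_of_le' h1 h2 ?_ ?_
  · filter_upwards [Filter.eventually_ge_atTop d] with k hk
    obtain ⟨j, rfl⟩ : ∃ j, k = d - 1 + (j + 1) := ⟨k - d, by omega⟩
    rw [← mul_div_assoc]
    refine div_le_div_of_nonneg_right ?_ (by positivity)
    have h3 : r * (n + j).choose n ≤ (L (d - 1 + (j + 1))).toNat := by
      have := ENat.toNat_le_toNat (hlow j) (hfin (d - 1 + j))
      rwa [ENat.toNat_natCast] at this
    have h4 := Nat.pow_sub_le_descFactorial (n + j) n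
    rw [Nat.descFactorial_eq_factorial_mul_choose, show n + j + 1 - n = j + 1 by omega] at h4
    have h5 : r * (j + 1) ^ n ≤ n.factorial * (L (d - 1 + (j + 1))).toNat := by
      calc r * (j + 1) ^ n ≤ r * (n.factorial * (n + j).choose n) := Nat.mul_le_mul_left _ h4
        _ = n.factorial * (r * (n + j).choose n) := by ring
        _ ≤ _ := Nat.mul_le_mul_left _ h3
    have h6 : ((d - 1 + (j + 1) : ℕ) : ℝ) + -((d - 1 : ℕ) : ℝ) = ((j + 1 : ℕ) : ℝ) := by
      push_cast; ring
    rw [h6]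
    exact_mod_cast h5
  · filter_upwards [Filter.eventually_ne_atTop 0] with k hk
    obtain ⟨j, rfl⟩ := Nat.exists_eq_succ_of_ne_zero hk
    rw [← mul_div_assoc]
    refine div_le_div_of_nonneg_right ?_ (by positivity)
    have h3 : (L (j + 1)).toNat ≤ r * (n + j).choose n := by
      have := ENat.toNat_le_toNat (hup j) (ENat.natCast_ne_top _)
      rwa [ENat.toNat_natCast] at this
    have h4 := Nat.descFactorial_le_pow (n + j) n
    rw [Nat.descFactorial_eq_factorial_mul_choose] at h4
    have h5 : n.factorial * (L (j + 1)).toNat ≤ r * (j + 1 + n) ^ n := by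
      calc n.factorial * (L (j + 1)).toNat ≤ n.factorial * (r * (n + j).choose n) :=
            Nat.mul_le_mul_left _ h3
        _ = r * (n.factorial * (n + j).choose n) := by ring
        _ ≤ r * (n + j) ^ n := Nat.mul_le_mul_left _ h4
        _ ≤ _ := Nat.mul_le_mul_left _ (Nat.pow_le_pow_left (by omega) _)
    exact_mod_cast h5

/-- By uniqueness of limits, Ulrich means that `N/𝔪N` has length equal to the rank, which is the
length of `N/𝔫N`. The surjection `N/𝔫N → N/𝔪N` between modules of equal finite length is injective,
so `𝔪N = 𝔫N`, that is, `zN ⊆ 𝔫N`. -/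
theorem isUlrich_iff (hd : d ≠ 0) (hf : f ∈ maximalIdeal S ^ d) :
    IsUlrich (BranchedCover S d f) N ↔
      ∀ x : N, z S d f • x ∈ maximalIdeal S • (⊤ : Submodule S N) := by
  have hf1 : f ∈ maximalIdeal S := Ideal.pow_le_self hd hf
  have hmcm := isMCM_of_free hd hf1 N
  have := hmcm.1
  have hnoeth := isNoetherianRing hd hf1
  have hmult := hasMultiplicity_finrank N hd hf
  have hI : Submodule.restrictScalars S ((maximalIdeal S).map (algebraMap S (BranchedCover S d f)) •
      (⊤ : Submodule (BranchedCover S d f) N)) = maximalIdeal S • (⊤ : Submodule S N) := by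
    rw [Ideal.smul_restrictScalars, Submodule.restrictScalars_top]
  have hIm : (maximalIdeal S).map (algebraMap S (BranchedCover S d f)) •
      (⊤ : Submodule (BranchedCover S d f) N) ≤
      maximalIdeal (BranchedCover S d f) • (⊤ : Submodule (BranchedCover S d f) N) :=
    Submodule.smul_mono_left (le_sup_left.trans (maximalIdeal_eq (S := S) (d := d) (f := f)).ge)
  have hr : (Module.finrank S N : ℕ∞) = Module.length (BranchedCover S d f)
      (N ⧸ (maximalIdeal S).map (algebraMap S (BranchedCover S d f)) •
        (⊤ : Submodule (BranchedCover S d f) N)) := by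
    rw [length_quotient_map_smul_top, length_quotient_smul_top, length_quotient_maximalIdeal, mul_one]
  have h1 : IsUlrich (BranchedCover S d f) N ↔
      (⊤ : Submodule (BranchedCover S d f) N).spanFinrank = Module.finrank S N := by
    constructor
    · rintro ⟨-, s, hs, ht⟩
      obtain ⟨s', hs', ht'⟩ := hmult
      obtain rfl : s = s' := by
        rw [hs] at hs'; exact_mod_cast hs'
      exact_mod_cast tendsto_nhds_unique ht ht'
    · intro h
      exact ⟨hmcm, h ▸ hmult⟩
  rw [h1, ← Nat.cast_inj (R := ℕ∞), spanFinrank_top_eq_length, hr]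
  constructor
  · intro h x
    have hinj := Module.length_eq_add_of_exact
      (LinearMap.ker (Submodule.factor hIm)).subtype (Submodule.factor hIm)
      (Submodule.subtype_injective _) (Submodule.factor_surjective _)
      (by
        rw [LinearMap.exact_iff]; simp)
    rw [h] at hinj
    have h0 : Module.length (BranchedCover S d f) (LinearMap.ker (Submodule.factor hIm)) = 0 := by
      have hne : Module.length (BranchedCover S d f)
          (N ⧸ (maximalIdeal S).map (algebraMap S (BranchedCover S d f)) •
            (⊤ : Submodule (BranchedCover S d f) N)) ≠ ⊤ := hr ▸ ENat.natCast_ne_top _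
      exact ENat.add_left_injective_of_ne_top hne (hinj.symm.trans (zero_add _).symm)
    rw [Module.length_eq_zero_iff] at h0
    have hz : z S d f • x ∈
        maximalIdeal (BranchedCover S d f) • (⊤ : Submodule (BranchedCover S d f) N) := by
      refine Submodule.smul_mem_smul ?_ trivial
      rw [maximalIdeal_eq]
      exact Ideal.mem_sup_right (Ideal.mem_span_singleton_self _)
    rw [← hI, Submodule.restrictScalars_mem, ← Submodule.Quotient.mk_eq_zero]
    have hk : Submodule.Quotient.mk (z S d f • x) ∈ LinearMap.ker (Submodule.factor hIm) := by
      rw [LinearMap.mem_ker]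
      exact (Submodule.Quotient.mk_eq_zero _).mpr hz
    exact congrArg Subtype.val (Subsingleton.elim
      (⟨_, hk⟩ : LinearMap.ker (Submodule.factor hIm)) 0)
  · intro h
    have : (maximalIdeal S).map (algebraMap S (BranchedCover S d f)) •
      (⊤ : Submodule (BranchedCover S d f) N) =
      maximalIdeal (BranchedCover S d f) • (⊤ : Submodule (BranchedCover S d f) N) := by
      refine le_antisymm hIm ?_
      conv_lhs => rw [maximalIdeal_eq]
      rw [Submodule.sup_smul]
      refine sup_le le_rfl ?_
      rw [Submodule.ideal_span_singleton_smul]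
      rintro _ ⟨x, -, rfl⟩
      have := h x
      rw [← hI] at this
      exact this
    rw [this]

omit [IsAdicComplete (maximalIdeal S) S] [IsLocalRing (BranchedCover S d f)] in
theorem flat_isReduced_iff (μ : S) (hd : d ≠ 0) (hμ : μ ^ d = -1) :
    (flat (f := f) μ hμ N).IsReduced ↔
      ∀ x : N, z S d f • x ∈ maximalIdeal S • (⊤ : Submodule S N) := by
  have hu : IsUnit μ := (isUnit_pow_iff hd).mp (hμ ▸ isUnit_one.neg)
  constructor
  · intro h x
    have h1 := h 0 ⟨x, rfl⟩
    have h2 : μ • (z S d f • x) ∈ maximalIdeal S • (⊤ : Submodule S N) := h1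
    exact (Submodule.smul_mem_iff_of_isUnit _ hu).mp h2
  · rintro h i _ ⟨x, rfl⟩
    exact Submodule.smul_mem (maximalIdeal S • (⊤ : Submodule S N)) μ (h x)

end

end BranchedCover

/-- A root of `X^d + 1` in the algebraically closed residue field lifts by Hensel's lemma; the
derivative `d b^(d-1)` is a unit because `d` is. -/
theorem exists_pow_eq_neg_one {S : Type*} [CommRing S] [IsLocalRing S]
    [IsAdicComplete (maximalIdeal S) S] [IsAlgClosed (ResidueField S)] (d : ℕ)
    (hchar : (d : ResidueField S) ≠ 0) : ∃ μ : S, μ ^ d = -1 := by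
  have hd : d ≠ 0 := by rintro rfl; simp at hchar
  have hH : HenselianRing S (maximalIdeal S) := inferInstance
  obtain ⟨a, ha⟩ := IsAlgClosed.exists_pow_nat_eq (-1 : ResidueField S) (Nat.pos_of_ne_zero hd)
  obtain ⟨b, rfl⟩ := residue_surjective a
  have hb : IsUnit b := by
    rw [← residue_ne_zero_iff_isUnit]
    intro h
    rw [h, zero_pow hd] at ha
    exact one_ne_zero (neg_eq_zero.mp ha.symm)
  obtain ⟨μ, hμ, -⟩ := hH.is_henselian (Polynomial.X ^ d + Polynomial.C 1)
    (Polynomial.monic_X_pow_add_C 1 hd) b (by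
      rw [← residue_eq_zero_iff]
      simp [ha]) (by
      refine IsUnit.map _ ?_
      have : IsUnit (d : S) := by
        rw [← residue_ne_zero_iff_isUnit]
        simpa using hchar
      simpa [Polynomial.derivative_X_pow] using this.mul (hb.pow (d - 1)))
  refine ⟨μ, ?_⟩
  rw [Polynomial.IsRoot.def] at hμ
  simpa [eq_neg_iff_add_eq_zero] using hμ

/-! ### Matrix factorizations as modules over a free algebra -/

/-- The range of `g` contains a copy of `L`, so it has the full rank of `M`; the kernel has rank `0`
in a torsion-free module and vanishes. -/
theorem injective_of_injective_comp_of_finrank_eq {S : Type*} [CommRing S] [IsDomain S]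
    {L M N : Type*} [AddCommGroup L] [AddCommGroup M] [AddCommGroup N] [Module S L] [Module S M]
    [Module S N] [Module.Free S M] [Module.Finite S M] [IsNoetherianRing S]
    (g : M →ₗ[S] N) (h : L →ₗ[S] M) (hgh : Function.Injective (g ∘ₗ h))
    (hr : Module.finrank S L = Module.finrank S M) : Function.Injective g := by
  have h1 := Submodule.finrank_quotient_add_finrank (LinearMap.ker g)
  rw [g.quotKerEquivRange.finrank_eq] at h1
  have h2 : Module.finrank S L ≤ Module.finrank S (LinearMap.range g) :=
    LinearMap.finrank_le_finrank_of_injective (f := g.rangeRestrict ∘ₗ h) (by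
      intro x y hxy
      exact hgh (congrArg Subtype.val hxy))
  rw [← LinearMap.ker_eq_bot, ← Submodule.finrank_eq_zero (R := S)]
  omega

namespace MatFac

section

variable {S : Type u} [CommRing S] {d : ℕ} {f : S}

/-- The direct sum of the modules in a matrix factorization. -/
def Total (X : MatFac S d f) : Type u := ∀ i, X.F i

variable (X Y Z : MatFac S d f)

instance : AddCommGroup X.Total := inferInstanceAs (AddCommGroup (∀ i, X.F i))

instance : Module S X.Total := inferInstanceAs (Module S (∀ i, X.F i))

instance [NeZero d] : Module.Free S X.Total := inferInstanceAs (Module.Free S (∀ i, X.F i))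

instance [NeZero d] : Module.Finite S X.Total := inferInstanceAs (Module.Finite S (∀ i, X.F i))

/-- The projection of the total module to a component. -/
def proj (i : ZMod d) : X.Total →ₗ[S] X.F i := LinearMap.proj i

/-- The inclusion of a component in the total module. -/
def incl (i : ZMod d) : X.F i →ₗ[S] X.Total := LinearMap.single S X.F i

/-- The cyclic endomorphism of the total module. -/
def cyc : Module.End S X.Total := cyclicMap X.φ

variable {X Y Z}

@[ext]
theorem Total.ext {x y : X.Total} (h : ∀ i, X.proj i x = X.proj i y) : x = y := funext h

@[simp]
theorem proj_incl (i : ZMod d) (x : X.F i) : X.proj i (X.incl i x) = x := Pi.single_eq_same i x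

theorem proj_incl_ne {i j : ZMod d} (h : j ≠ i) (x : X.F i) : X.proj j (X.incl i x) = 0 :=
  Pi.single_eq_of_ne h x

theorem sum_incl_proj [NeZero d] (x : X.Total) : ∑ i, X.incl i (X.proj i x) = x :=
  Finset.univ_sum_single x

@[simp]
theorem proj_cyc (i : ZMod d) (x : X.Total) : X.proj i (X.cyc x) = X.φ i (X.proj (i + 1) x) := rfl

theorem cyc_incl (i : ZMod d) (x : X.F (i + 1)) :
    X.cyc (X.incl (i + 1) x) = X.incl i (X.φ i x) := by
  ext j
  by_cases h : j = i
  · subst h; simp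
  · rw [proj_cyc, proj_incl_ne h, proj_incl_ne (fun h' => h (add_right_cancel h')), map_zero]

theorem proj_cyc_pow_eq_zero (k : ℕ) : ∀ (i : ZMod d) (x : X.Total), X.proj (i + k) x = 0 →
    X.proj i ((X.cyc ^ k) x) = 0 := by
  induction k with
  | zero =>
    intro i x h
    rw [Nat.cast_zero, add_zero] at h
    exact h
  | succ k ih =>
    intro i x h
    rw [pow_succ, Module.End.mul_apply]
    apply ih
    rw [Nat.cast_succ, ← add_assoc] at h
    rw [proj_cyc, h, map_zero]

theorem proj_one_cyc_pow (x : X.Total) : X.proj 1 ((X.cyc ^ d) x) = f • X.proj 1 x :=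
  X.comp_eq x

theorem φ_injective [IsDomain S] [IsNoetherianRing S] [NeZero d] (hf : f ≠ 0) (i : ZMod d) :
    Function.Injective (X.φ i) := by
  -- Going `a` steps from component `1` reaches `i + 1`; then `φ i` and `b` further steps return to
  -- `1`, with total effect multiplication by `f`.
  set a := (-i).val with ha
  have had : a < d := ZMod.val_lt _
  have hai : (a : ZMod d) = -i := ZMod.natCast_zmod_val _
  obtain ⟨b, hb⟩ : ∃ b, b + (1 + a) = d := ⟨d - 1 - a, by omega⟩
  have hbi : 1 + (b : ZMod d) = i := by
    have := congrArg (Nat.cast : ℕ → ZMod d) hb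
    push_cast at this
    rw [hai, ZMod.natCast_self] at this
    linear_combination this
  refine injective_of_injective_comp_of_finrank_eq (X.φ i)
    (X.proj (i + 1) ∘ₗ (X.cyc ^ a : Module.End S X.Total) ∘ₗ X.incl 1) ?_ (X.finrank_eq _ _)
  rw [← LinearMap.ker_eq_bot, LinearMap.ker_eq_bot']
  intro x hx
  have h1 : X.proj (1 + (b : ZMod d)) ((X.cyc ^ (1 + a)) (X.incl 1 x)) = 0 := by
    rw [hbi, pow_add, pow_one]
    exact hx
  have h2 := proj_cyc_pow_eq_zero b 1 _ h1
  rw [← Module.End.mul_apply, ← pow_add, hb, proj_one_cyc_pow, proj_incl] at h2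
  exact (smul_eq_zero.mp h2).resolve_left hf

theorem proj_eq_zero_of_proj_cyc_pow [IsDomain S] [IsNoetherianRing S] [NeZero d] (hf : f ≠ 0)
    (k : ℕ) : ∀ (i : ZMod d) (x : X.Total), X.proj i ((X.cyc ^ k) x) = 0 →
    X.proj (i + k) x = 0 := by
  induction k with
  | zero =>
    intro i x h
    rw [Nat.cast_zero, add_zero]
    exact h
  | succ k ih =>
    intro i x h
    rw [pow_succ, Module.End.mul_apply] at h
    have := ih i _ h
    rw [proj_cyc] at this
    rw [Nat.cast_succ, ← add_assoc]
    exact φ_injective hf _ (this.trans (map_zero _).symm)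

variable (X) in
-- The definition only gives the product based at component `1`. Transporting component `i` there by
-- `cyc^(i-1)`, which commutes with `cyc^d` and is injective on that component, gives every
-- rotation.
theorem cyc_pow [IsDomain S] [IsNoetherianRing S] [NeZero d] (hf : f ≠ 0) :
    X.cyc ^ d = algebraMap S _ f := by
  ext x i
  rw [← sub_eq_zero, ← map_sub]
  set y : X.Total := (X.cyc ^ d) x - (algebraMap S (Module.End S X.Total) f) x
  have h : X.proj 1 ((X.cyc ^ (i - 1).val) y) = 0 := by
    have h1 := proj_one_cyc_pow ((X.cyc ^ (i - 1).val) x)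
    rw [← Module.End.mul_apply, ← pow_add, add_comm, pow_add, Module.End.mul_apply] at h1
    simp only [y, map_sub, h1]
    simp
  have := proj_eq_zero_of_proj_cyc_pow hf _ _ _ h
  rwa [ZMod.natCast_zmod_val, add_sub_cancel] at this

/-! #### The module structure -/

/-- The free algebra on the projections to the components and the cyclic endomorphism. -/
abbrev Alg (S : Type u) [CommRing S] (d : ℕ) : Type u := FreeAlgebra S (Option (ZMod d))

variable (X) in
/-- The action of the free algebra on the total module. -/
noncomputable def toEnd : Alg S d →ₐ[S] Module.End S X.Total :=
  FreeAlgebra.lift S fun o => o.elim X.cyc fun i => X.incl i ∘ₗ X.proj i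

noncomputable instance : Module (Alg S d) X.Total := Module.compHom _ X.toEnd.toRingHom

theorem smul_def (a : Alg S d) (x : X.Total) : a • x = X.toEnd a x := rfl

instance : IsScalarTower S (Alg S d) X.Total where
  smul_assoc s a x := by rw [smul_def, smul_def, map_smul]; rfl

theorem ι_none_smul (x : X.Total) : FreeAlgebra.ι S (none : Option (ZMod d)) • x = X.cyc x := by
  rw [smul_def, toEnd, FreeAlgebra.lift_ι_apply]; rfl

theorem ι_some_smul (i : ZMod d) (x : X.Total) :
    FreeAlgebra.ι S (some i) • x = X.incl i (X.proj i x) := by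
  rw [smul_def, toEnd, FreeAlgebra.lift_ι_apply]; rfl

/-- The map of total modules given by a morphism of matrix factorizations. -/
noncomputable def mapTotal (h : ∀ i, X.F i →ₗ[S] Y.F i)
    (hc : ∀ i x, h i (X.φ i x) = Y.φ i (h (i + 1) x)) : X.Total →ₗ[Alg S d] Y.Total where
  toFun x := fun i => h i (X.proj i x)
  map_add' x y := by
    refine Total.ext fun i => ?_
    exact map_add (h i) _ _
  map_smul' a x := by
    let H : X.Total →ₗ[S] Y.Total := LinearMap.pi fun i => h i ∘ₗ X.proj i
    change H (a • x) = a • H x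
    have hH : ∀ i x, Y.proj i (H x) = h i (X.proj i x) := fun i x => rfl
    induction a using FreeAlgebra.induction generalizing x with
    | grade0 r => rw [algebraMap_smul, algebraMap_smul, map_smul]
    | grade1 o =>
      cases o with
      | none =>
        rw [ι_none_smul, ι_none_smul]
        ext i
        rw [hH, proj_cyc, hc, proj_cyc, hH]
      | some j =>
        rw [ι_some_smul, ι_some_smul]
        ext i
        rw [hH]
        by_cases hij : i = j
        · subst hij; simp [hH]
        · rw [proj_incl_ne hij, proj_incl_ne hij, map_zero]
    | mul a b ha hb => rw [mul_smul, mul_smul, ha, hb]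
    | add a b ha hb => rw [add_smul, add_smul, map_add, ha, hb]

@[simp]
theorem proj_mapTotal (h : ∀ i, X.F i →ₗ[S] Y.F i)
    (hc : ∀ i x, h i (X.φ i x) = Y.φ i (h (i + 1) x)) (i : ZMod d) (x : X.Total) :
    Y.proj i (mapTotal h hc x) = h i (X.proj i x) := rfl

theorem map_cyc (e : X.Total →ₗ[Alg S d] Y.Total) (x : X.Total) : e (X.cyc x) = Y.cyc (e x) := by
  rw [← ι_none_smul, map_smul, ι_none_smul]

theorem map_incl (e : X.Total →ₗ[Alg S d] Y.Total) (i : ZMod d) (x : X.F i) :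
    e (X.incl i x) = Y.incl i (Y.proj i (e (X.incl i x))) := by
  conv_lhs => rw [← proj_incl i x, ← ι_some_smul, map_smul, ι_some_smul]

/-- Linearity over the free algebra means commuting with the projections, so the map is diagonal,
and with the cyclic map, so its entries form a morphism. -/
theorem Iso.ofTotal (e : X.Total ≃ₗ[Alg S d] Y.Total) : Nonempty (X.Iso Y) := by
  have h1 : ∀ i x, e (X.incl i x) = Y.incl i (Y.proj i (e (X.incl i x))) :=
    map_incl e.toLinearMap
  have h2 : ∀ i x, e.symm (Y.incl i x) = X.incl i (X.proj i (e.symm (Y.incl i x))) :=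
    map_incl e.symm.toLinearMap
  refine ⟨⟨fun i => LinearEquiv.ofLinearMap (Y.proj i ∘ₗ (e.toLinearMap.restrictScalars S) ∘ₗ X.incl i)
    (X.proj i ∘ₗ (e.symm.toLinearMap.restrictScalars S) ∘ₗ Y.incl i) ?_ ?_, fun i x => ?_⟩⟩
  · ext x
    simp only [LinearMap.comp_apply, LinearMap.restrictScalars_apply, LinearEquiv.coe_coe]
    rw [← h2, e.apply_symm_apply, proj_incl]; rfl
  · ext x
    simp only [LinearMap.comp_apply, LinearMap.restrictScalars_apply, LinearEquiv.coe_coe]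
    rw [← h1, e.symm_apply_apply, proj_incl]; rfl
  · simp only [LinearEquiv.coe_ofLinearMap, LinearMap.comp_apply, LinearMap.restrictScalars_apply]
    rw [← cyc_incl, map_cyc, proj_cyc]

/-- The isomorphism of total modules given by an isomorphism of matrix factorizations. -/
noncomputable def Iso.total (e : X.Iso Y) : X.Total ≃ₗ[Alg S d] Y.Total :=
  LinearEquiv.ofLinearMap (mapTotal (fun i => (e.equiv i).toLinearMap) e.comm)
    (mapTotal (fun i => (e.equiv i).symm.toLinearMap) (fun i x => by
      rw [LinearEquiv.coe_coe, LinearEquiv.symm_apply_eq, e.comm]; simp))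
    (by ext x i; simp) (by ext x i; simp)

theorem nontrivial_total (h : ¬ X.IsZero) : Nontrivial X.Total := by
  rw [IsZero, not_forall] at h
  obtain ⟨i, hi⟩ := h
  rw [not_subsingleton_iff_nontrivial] at hi
  exact (Function.LeftInverse.injective (proj_incl (X := X) i)).nontrivial

theorem isIndecomposable_of_total (h : IsIndecModule (Alg S d) X.Total) : X.IsIndecomposable := by
  constructor
  · intro h0
    have := h.1
    obtain ⟨x, hx⟩ := exists_ne (0 : X.Total)
    exact hx (Total.ext fun i => (h0 i).elim _ _)
  · rintro Y Z ⟨e⟩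
    have h' := h.congr e.total
    let p₁ : (Y.directSum Z).Total →ₗ[Alg S d] Y.Total :=
      mapTotal (fun i => LinearMap.fst S (Y.F i) (Z.F i)) (fun i x => rfl)
    let p₂ : (Y.directSum Z).Total →ₗ[Alg S d] Z.Total :=
      mapTotal (fun i => LinearMap.snd S (Y.F i) (Z.F i)) (fun i x => rfl)
    let i₁ : Y.Total →ₗ[Alg S d] (Y.directSum Z).Total :=
      mapTotal (fun i => LinearMap.inl S (Y.F i) (Z.F i)) (fun i x => by
        exact Prod.ext rfl (map_zero (Z.φ i)).symm)
    let i₂ : Z.Total →ₗ[Alg S d] (Y.directSum Z).Total :=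
      mapTotal (fun i => LinearMap.inr S (Y.F i) (Z.F i)) (fun i x => by
        exact Prod.ext (map_zero (Y.φ i)).symm rfl)
    have hc : IsCompl (LinearMap.ker p₁) (LinearMap.ker p₂) := by
      constructor
      · rw [Submodule.disjoint_def]
        intro x hx1 hx2
        refine Total.ext fun i => Prod.ext ?_ ?_
        · exact congrArg (Y.proj i) hx1
        · exact congrArg (Z.proj i) hx2
      · rw [codisjoint_iff, eq_top_iff]
        intro x _
        refine Submodule.mem_sup.mpr ⟨i₂ (p₂ x), ?_, i₁ (p₁ x), ?_, ?_⟩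
        · exact Total.ext fun i => rfl
        · exact Total.ext fun i => rfl
        · refine Total.ext fun i => Prod.ext (zero_add _) (add_zero _)
    rcases h'.2 _ _ hc with h1 | h1
    · right
      intro i
      refine ⟨fun a b => ?_⟩
      have : i₂ (Z.incl i (a - b)) = 0 := by
        rw [← Submodule.mem_bot (Alg S d), ← h1]
        exact Total.ext fun i => rfl
      have h2 := congrArg (fun y => (((Y.directSum Z).proj i y : Y.F i × Z.F i)).2) this
      have h3 : Z.proj i (Z.incl i (a - b)) = 0 := h2
      rwa [proj_incl, sub_eq_zero] at h3
    · left
      intro i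
      refine ⟨fun a b => ?_⟩
      have : i₁ (Y.incl i (a - b)) = 0 := by
        rw [← Submodule.mem_bot (Alg S d), ← h1]
        exact Total.ext fun i => rfl
      have h2 := congrArg (fun y => (((Y.directSum Z).proj i y : Y.F i × Z.F i)).1) this
      have h3 : Y.proj i (Y.incl i (a - b)) = 0 := h2
      rwa [proj_incl, sub_eq_zero] at h3

/-! #### Summands -/

section Summand

variable (P : Submodule (Alg S d) X.Total)

/-- The component of a submodule of the total module. -/
noncomputable def component (i : ZMod d) : Submodule S (X.F i) := (P.restrictScalars S).comap (X.incl i)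

theorem mem_component {i : ZMod d} {x : X.F i} : x ∈ component P i ↔ X.incl i x ∈ P := Iff.rfl

variable {P} in
theorem proj_mem_component {x : X.Total} (hx : x ∈ P) (i : ZMod d) :
    X.proj i x ∈ component P i := by
  rw [mem_component, ← ι_some_smul]
  exact P.smul_mem _ hx

theorem φ_mem_component (i : ZMod d) {x : X.F (i + 1)} (hx : x ∈ component P (i + 1)) :
    X.φ i x ∈ component P i := by
  rw [mem_component, ← cyc_incl, ← ι_none_smul]
  exact P.smul_mem _ hx

/-- The retraction to the component of a summand. -/
noncomputable def toComponent (π : X.Total →ₗ[Alg S d] P) (i : ZMod d) :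
    X.F i →ₗ[S] component P i :=
  (X.proj i ∘ₗ ((P.subtype ∘ₗ π).restrictScalars S) ∘ₗ X.incl i).codRestrict _
    fun x => proj_mem_component (π (X.incl i x)).2 i

theorem toComponent_apply (π : X.Total →ₗ[Alg S d] P) (hπ : ∀ x : P, π x = x) (i : ZMod d)
    (x : component P i) : toComponent P π i x = x := by
  ext
  change X.proj i (π (X.incl i x)) = x
  have := hπ ⟨X.incl i x, x.2⟩
  exact (congrArg (fun y : P => X.proj i y) this).trans (proj_incl i _)

variable [IsLocalRing S] [IsNoetherianRing S] [IsDomain S] [NeZero d] (hf : f ≠ 0)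
  (π : X.Total →ₗ[Alg S d] P) (hπ : ∀ x : P, π x = x)

omit [IsDomain S] [NeZero d] in
include π hπ in
theorem free_component (i : ZMod d) : Module.Free S (component P i) := by
  have : Module.Projective S (component P i) :=
    Module.Projective.of_split (component P i).subtype (toComponent P π i)
      (LinearMap.ext (toComponent_apply P π hπ i))
  exact Module.free_of_flat_of_isLocalRing

/-- The matrix factorization given by a summand of the total module. -/
noncomputable def summand : MatFac S d f where
  F i := component P i
  instFree i := free_component P π hπ i
  finrank_eq := by
    -- The injective maps `φ i` make the ranks monotone around a cycle, hence constant.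
    have h1 : ∀ i, Module.finrank S (component P (i + 1)) ≤ Module.finrank S (component P i) :=
      fun i => LinearMap.finrank_le_finrank_of_injective
        (f := (X.φ i).restrict (fun x hx => φ_mem_component P i hx)) (by
          intro x y hxy
          exact Subtype.ext (φ_injective hf i (congrArg Subtype.val hxy)))
    have h2 : ∀ (k : ℕ) i,
        Module.finrank S (component P (i + k)) ≤ Module.finrank S (component P i) := by
      intro k
      induction k with
      | zero => intro i; rw [Nat.cast_zero, add_zero]
      | succ k ih =>
        intro i
        rw [Nat.cast_succ, ← add_assoc]
        exact (h1 _).trans (ih i)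
    have h3 : ∀ i j, Module.finrank S (component P i) ≤ Module.finrank S (component P j) := by
      intro i j
      have := h2 (i - j).val j
      rwa [ZMod.natCast_zmod_val, add_sub_cancel] at this
    exact fun i j => le_antisymm (h3 i j) (h3 j i)
  φ i := (X.φ i).restrict (fun x hx => φ_mem_component P i hx)
  comp_eq := by
    have key : ∀ (k : ℕ) (x : ∀ i, component P i) (i : ZMod d),
        ((cyclicMap (F := fun i => component P i)
          (fun i => (X.φ i).restrict (fun x hx => φ_mem_component P i hx)) ^ k) x i : X.F i) =
          (cyclicMap X.φ ^ k) (fun j => (x j : X.F j)) i := by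
      intro k
      induction k with
      | zero => intro x i; simp
      | succ k ih =>
        intro x i
        rw [pow_succ, pow_succ, Module.End.mul_apply, ih]
        rfl
    intro x
    refine Subtype.ext ?_
    rw [key, X.comp_eq]
    rfl

/-- The inclusion of a summand. -/
noncomputable def summandIncl : (summand P hf π hπ).Total →ₗ[Alg S d] X.Total :=
  mapTotal (fun i => (⟨⟨Subtype.val, fun _ _ => rfl⟩, fun _ _ => rfl⟩ :
    (summand P hf π hπ).F i →ₗ[S] X.F i)) (fun _ _ => rfl)

theorem summandIncl_mem (x : (summand P hf π hπ).Total) : summandIncl P hf π hπ x ∈ P := by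
  rw [← sum_incl_proj (summandIncl P hf π hπ x)]
  exact Submodule.sum_mem _ fun i _ => Subtype.prop (x i : component P i)

/-- The total module of a summand. -/
noncomputable def summandTotal : (summand P hf π hπ).Total ≃ₗ[Alg S d] P :=
  LinearEquiv.ofBijective
    ((summandIncl P hf π hπ).codRestrict P (summandIncl_mem P hf π hπ)) (by
    constructor
    · intro x y hxy
      refine Total.ext fun i => Subtype.ext ?_
      exact congrArg (fun z : P => X.proj i z) hxy
    · intro y
      refine ⟨fun i => ⟨X.proj i y, proj_mem_component y.2 i⟩, ?_⟩
      exact Subtype.ext (Total.ext fun i => rfl))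

/-- The retraction onto a component carries `𝔫 F i` into 𝔫 times the component and fixes the image
of the restricted map. -/
theorem isReduced_summand (hX : X.IsReduced) : (summand P hf π hπ).IsReduced := by
  intro i y hy
  obtain ⟨x, rfl⟩ : ∃ x : component P (i + 1),
    (X.φ i).restrict (fun x hx => φ_mem_component P i hx) x = y := hy
  have h1 : X.φ i x ∈ maximalIdeal S • (⊤ : Submodule S (X.F i)) := hX i ⟨_, rfl⟩
  have h2 := Submodule.mem_map_of_mem (f := toComponent P π i) h1
  rw [Submodule.map_smul''] at h2
  have h3 : toComponent P π i (X.φ i x) =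
      (X.φ i).restrict (fun x hx => φ_mem_component P i hx) x :=
    toComponent_apply P π hπ i ((X.φ i).restrict (fun x hx => φ_mem_component P i hx) x)
  rw [h3] at h2
  exact Submodule.smul_mono le_rfl le_top h2

end Summand

/-- Submodules over the free algebra are graded, so complementary ones are complementary in each
component and split `X` as a direct sum of matrix factorizations. -/
theorem total_of_isIndecomposable [IsLocalRing S] [IsNoetherianRing S] [IsDomain S] [NeZero d]
    (hf : f ≠ 0) (h : X.IsIndecomposable) : IsIndecModule (Alg S d) X.Total := by
  refine ⟨nontrivial_total h.1, fun p q hpq => ?_⟩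
  have hP : ∀ x : p, Submodule.projectionOnto p q hpq x = x :=
    Submodule.projectionOnto_apply_left hpq
  have hQ : ∀ x : q, Submodule.projectionOnto q p hpq.symm x = x :=
    Submodule.projectionOnto_apply_left hpq.symm
  have hc : ∀ i, IsCompl (component p i) (component q i) := by
    intro i
    constructor
    · rw [Submodule.disjoint_def]
      intro x hx hy
      have := Submodule.disjoint_def.mp hpq.disjoint _ hx hy
      rw [← proj_incl i x, this, map_zero]
    · rw [codisjoint_iff, eq_top_iff]
      intro x _
      obtain ⟨a, ha, b, hb, hab⟩ := Submodule.mem_sup.mp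
        (hpq.sup_eq_top ▸ Submodule.mem_top : X.incl i x ∈ p ⊔ q)
      refine Submodule.mem_sup.mpr ⟨_, proj_mem_component ha i, _, proj_mem_component hb i, ?_⟩
      rw [← map_add, hab, proj_incl]
  have hzero : ∀ P : Submodule (Alg S d) X.Total, (∀ i, Subsingleton (component P i)) → P = ⊥ := by
    intro P hP
    rw [eq_bot_iff]
    intro x hx
    refine Total.ext fun i => ?_
    exact congrArg Subtype.val ((hP i).elim ⟨_, proj_mem_component hx i⟩ 0)
  refine (h.2 (summand p hf _ hP) (summand q hf _ hQ) ⟨⟨fun i =>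
    (Submodule.prodEquivOfIsCompl _ _ (hc i)).symm, fun i x => ?_⟩⟩).imp (hzero p) (hzero q)
  have key : ∀ y : component p (i + 1) × component q (i + 1),
      X.φ i (Submodule.prodEquivOfIsCompl _ _ (hc (i + 1)) y) =
        Submodule.prodEquivOfIsCompl _ _ (hc i)
          (((X.φ i).restrict (fun x hx => φ_mem_component p i hx)).prodMap
            ((X.φ i).restrict (fun x hx => φ_mem_component q i hx)) y) := by
    intro y
    simp only [Submodule.coe_prodEquivOfIsCompl', map_add]
    rfl
  have := key ((Submodule.prodEquivOfIsCompl _ _ (hc (i + 1))).symm x)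
  rw [LinearEquiv.apply_symm_apply] at this
  exact (LinearEquiv.symm_apply_eq _).mpr this

end

end MatFac

/-! ### Finite type -/

namespace BranchedCover

theorem free_of_retract {S : Type u} [CommRing S] [IsLocalRing S] [IsNoetherianRing S] {d : ℕ}
    {f : S} {N : Type u} [AddCommGroup N] [Module (BranchedCover S d f) N] [Module S N]
    [IsScalarTower S (BranchedCover S d f) N] [Module.Free S N] [Module.Finite S N]
    (P : Submodule (BranchedCover S d f) N) (p : N →ₗ[BranchedCover S d f] P)
    (hp : ∀ x : P, p x = x) : Module.Free S P ∧ Module.Finite S P := by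
  have hfin : Module.Finite S P :=
    Module.Finite.of_injective (P.subtype.restrictScalars S) Subtype.val_injective
  have : Module.Projective S P :=
    Module.Projective.of_split (P.subtype.restrictScalars S) (p.restrictScalars S)
      (LinearMap.ext hp)
  exact ⟨Module.free_of_flat_of_isLocalRing, hfin⟩

end BranchedCover

section

variable {S : Type u} [CommRing S] [IsLocalRing S] [IsNoetherianRing S]
  [IsAdicComplete (maximalIdeal S) S] {d : ℕ} {f : S}

open BranchedCover

/-- The total module of a matrix factorization, as a module over the branched cover on which `z`
acts by `ν` times the cyclic endomorphism. -/
theorem MatFac.exists_module_branchedCover [IsDomain S] [NeZero d] (hf0 : f ≠ 0)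
    (hf : f ∈ maximalIdeal S) (ν : S) (hν : ν ^ d = -1) (X : MatFac S d f) :
    ∃ (_ : Module (BranchedCover S d f) X.Total) (_ : IsScalarTower S (BranchedCover S d f) X.Total),
      ∀ x : X.Total, z S d f • x = ν • X.cyc x := by
  have ht : (ν • X.cyc) ^ d = -algebraMap S (Module.End S X.Total) f := by
    rw [smul_pow, hν, X.cyc_pow hf0, neg_one_smul]
  let h := endHom (NeZero.ne d) hf (ν • X.cyc) ht
  let _ : Module (BranchedCover S d f) X.Total := Module.compHom _ h.toRingHom
  have hsmul : ∀ (r : BranchedCover S d f) (x : X.Total), r • x = h r x := fun _ _ => rfl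
  refine ⟨inferInstance, ⟨fun s r x => ?_⟩, fun x => ?_⟩
  · rw [hsmul, hsmul, map_smul]; rfl
  · rw [hsmul, endHom_z]; rfl

/-- Only finitely many indecomposable matrix factorizations are summands of a given one. -/
theorem MatFac.exists_list_of_retract [IsDomain S] [NeZero d] (hf0 : f ≠ 0) (W : MatFac S d f) :
    ∃ L : List (MatFac S d f), ∀ Y : MatFac S d f, Y.IsIndecomposable →
      ∀ (a : Y.Total →ₗ[Alg S d] W.Total) (b : W.Total →ₗ[Alg S d] Y.Total),
        IsUnit (b ∘ₗ a : Module.End (Alg S d) Y.Total) → ∃ X ∈ L, Nonempty (Y.Iso X) := by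
  obtain ⟨ι, _, P, p, hp, hsum, hP⟩ :=
    exists_indecomposable_decomposition (Λ := Alg S d) S W.Total
  refine ⟨Finset.univ.toList.map fun j => summand (P j) hf0 (p j) (hp j), fun Y hY a b hab => ?_⟩
  have hY' := total_of_isIndecomposable hf0 hY
  have := hY'.1
  have := hY'.isLocalRing_end S
  obtain ⟨j, ⟨e⟩⟩ := IsIndecModule.exists_equiv_of_retract P p hsum hP a b hab
  exact ⟨_, List.mem_map_of_mem (by simp : j ∈ Finset.univ.toList),
    Iso.ofTotal (e.trans (summandTotal (P j) hf0 (p j) (hp j)).symm)⟩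

/-- The list must depend on `M` alone, which carries no `S`-structure of its own. One model `N₀` of
`M`, finite free over `S`, is fixed and every other `N` is compared with it; if there is no model,
the claim is vacuous. -/
theorem MatFac.exists_list_of_retract_flat [IsDomain S] [NeZero d] (hf0 : f ≠ 0) (μ : S)
    (hμ : μ ^ d = -1) (M : Type u) [AddCommGroup M] [Module (BranchedCover S d f) M] :
    ∃ L : List (MatFac S d f), ∀ (N : Type u) [AddCommGroup N] [Module (BranchedCover S d f) N]
      [Module S N] [IsScalarTower S (BranchedCover S d f) N] [Module.Free S N] [Module.Finite S N]
      (_ : N ≃ₗ[BranchedCover S d f] M) (Y : MatFac S d f), Y.IsIndecomposable →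
      ∀ (a : Y.Total →ₗ[Alg S d] (flat (f := f) μ hμ N).Total)
        (b : (flat (f := f) μ hμ N).Total →ₗ[Alg S d] Y.Total),
        IsUnit (b ∘ₗ a : Module.End (Alg S d) Y.Total) → ∃ X ∈ L, Nonempty (Y.Iso X) := by
  by_cases h : ∃ (N : Type u) (_ : AddCommGroup N) (_ : Module (BranchedCover S d f) N)
      (_ : Module S N) (_ : IsScalarTower S (BranchedCover S d f) N) (_ : Module.Free S N)
      (_ : Module.Finite S N), Nonempty (N ≃ₗ[BranchedCover S d f] M)
  · obtain ⟨N₀, _, _, _, _, _, _, ⟨e₀⟩⟩ := h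
    obtain ⟨L, hL⟩ := MatFac.exists_list_of_retract hf0 (flat (f := f) μ hμ N₀)
    refine ⟨L, fun N _ _ _ _ _ _ e Y hY a b hab => ?_⟩
    let g := e.trans e₀.symm
    let G : (flat (f := f) μ hμ N).Total →ₗ[Alg S d] (flat (f := f) μ hμ N₀).Total :=
      mapTotal (fun _ => g.toLinearMap.restrictScalars S) (fun i x => by
        exact (LinearMap.CompatibleSMul.map_smul g.toLinearMap μ _).trans
          (congrArg (μ • ·) (g.map_smul _ _)))
    let G' : (flat (f := f) μ hμ N₀).Total →ₗ[Alg S d] (flat (f := f) μ hμ N).Total :=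
      mapTotal (fun _ => g.symm.toLinearMap.restrictScalars S) (fun i x => by
        exact (LinearMap.CompatibleSMul.map_smul g.symm.toLinearMap μ _).trans
          (congrArg (μ • ·) (g.symm.map_smul _ _)))
    refine hL Y hY (G ∘ₗ a) (b ∘ₗ G') ?_
    have hG : ∀ x, G' (G x) = x := fun x => Total.ext fun i => g.symm_apply_apply (x i)
    convert hab using 1
    ext x
    exact congrArg (fun y => Y.proj _ (b y)) (hG (a x))
  · refine ⟨[], fun N _ _ _ _ _ _ e => ?_⟩
    exact (h ⟨N, _, _, _, inferInstance, inferInstance, inferInstance, ⟨e⟩⟩).elim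

/-- Only finitely many indecomposable modules over the branched cover are summands of the module
given by a matrix factorization. -/
theorem BranchedCover.exists_list_of_retract [IsDomain S] [NeZero d] (hf0 : f ≠ 0)
    (hf : f ∈ maximalIdeal S) (ν : S) (hν : ν ^ d = -1) (X : MatFac S d f) :
    ∃ L : List (ModuleCat.{u} (BranchedCover S d f)), ∀ (N : Type u) [AddCommGroup N]
      [Module (BranchedCover S d f) N] [Module S N] [IsScalarTower S (BranchedCover S d f) N]
      [Module.Finite S N], IsIndecModule (BranchedCover S d f) N →
      ∀ (a : N →ₗ[S] X.Total) (b : X.Total →ₗ[S] N), (∀ x, a (z S d f • x) = ν • X.cyc (a x)) →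
        (∀ x, b (ν • X.cyc x) = z S d f • b x) → Function.Bijective (b ∘ₗ a) →
        ∃ M ∈ L, Nonempty (N ≃ₗ[BranchedCover S d f] M) := by
  obtain ⟨_, _, hz⟩ := X.exists_module_branchedCover hf0 hf ν hν
  obtain ⟨ι, _, P, p, hp, hsum, hP⟩ :=
    exists_indecomposable_decomposition (Λ := BranchedCover S d f) S X.Total
  refine ⟨Finset.univ.toList.map fun j => ModuleCat.of _ (P j), fun N _ _ _ _ _ hN a b ha hb hab => ?_⟩
  have := hN.1
  have := hN.isLocalRing_end S
  have hd := NeZero.ne d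
  obtain ⟨j, ⟨e⟩⟩ := IsIndecModule.exists_equiv_of_retract P p hsum hP
    (linearMapOfMapZSMul hd hf a fun x => by rw [ha, hz])
    (linearMapOfMapZSMul hd hf b fun x => by rw [hz, hb])
    ((Module.End.isUnit_iff _).mpr hab)
  exact ⟨_, List.mem_map_of_mem (by simp : j ∈ Finset.univ.toList), ⟨e⟩⟩

end

section

variable {S : Type u} [CommRing S] [IsRegularLocalRing S] [IsAdicComplete (maximalIdeal S) S]
  {d : ℕ} [NeZero d] {f : S} [IsLocalRing (BranchedCover S d f)] (hf0 : f ≠ 0)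
  (hf : f ∈ maximalIdeal S ^ d) {μ ν : S} (hμ : μ ^ d = -1) (hν : ν ^ d = -1) (hμν : μ * ν = 1)
include hf0 hf hμ hν hμν

open BranchedCover MatFac

theorem hasFiniteReducedMFType_of_hasFiniteUlrichType
    (h : HasFiniteUlrichType (BranchedCover S d f)) : HasFiniteReducedMFType S d f := by
  have := isDomain_of_isRegularLocalRing S
  have hd := NeZero.ne d
  have hf1 : f ∈ maximalIdeal S := Ideal.pow_le_self hd hf
  obtain ⟨n, M, hM⟩ := h
  choose L hL using fun k => MatFac.exists_list_of_retract_flat (S := S) hf0 μ hμ (M k)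
  suffices H : ∀ Y : MatFac S d f, Y.IsReduced → Y.IsIndecomposable →
      ∃ X ∈ (List.finRange n).flatMap L, Nonempty (Y.Iso X) by
    refine ⟨_, ((List.finRange n).flatMap L).get, fun Y hY hY' => ?_⟩
    obtain ⟨X, hX, e⟩ := H Y hY hY'
    obtain ⟨i, rfl⟩ := List.mem_iff_get.mp hX
    exact ⟨i, e⟩
  intro Y hYred hYind
  have hY' := total_of_isIndecomposable hf0 hYind
  have := hY'.1
  have := hY'.isLocalRing_end S
  obtain ⟨_, _, hz⟩ := Y.exists_module_branchedCover hf0 hf1 ν hν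
  have hμz : ∀ x : Y.Total, μ • z S d f • x = Y.cyc x := fun x => by
    rw [hz, smul_smul, hμν, one_smul]
  obtain ⟨ι, _, P, p, hp, hsum, hP⟩ :=
    exists_indecomposable_decomposition (Λ := BranchedCover S d f) S Y.Total
  have hfree := fun j => (free_of_retract (P j) (p j) (hp j)).1
  have hfin := fun j => (free_of_retract (P j) (p j) (hp j)).2
  have hcyc : ∀ x, Y.cyc x ∈ maximalIdeal S • (⊤ : Submodule S Y.Total) := by
    intro x
    rw [← sum_incl_proj (Y.cyc x)]
    refine Submodule.sum_mem _ fun i _ => ?_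
    have h1 := Submodule.mem_map_of_mem (f := Y.incl i) (hYred i ⟨Y.proj (i + 1) x, rfl⟩)
    rw [Submodule.map_smul''] at h1
    exact Submodule.smul_mono le_rfl le_top h1
  have hUlrich : ∀ j, IsUlrich (BranchedCover S d f) (P j) := by
    intro j
    rw [isUlrich_iff (S := S) (P j) hd hf]
    intro x
    have h1 : z S d f • (x : Y.Total) ∈ maximalIdeal S • (⊤ : Submodule S Y.Total) := by
      rw [hz]
      exact Submodule.smul_mem _ _ (hcyc x)
    have h2 := Submodule.mem_map_of_mem (f := (p j).restrictScalars S) h1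
    rw [Submodule.map_smul'', LinearMap.restrictScalars_apply, map_smul, hp] at h2
    exact Submodule.smul_mono le_rfl le_top h2
  -- The maps `a j` and `b j` realize `Y` as a retract of the sum of the `(P j)♭`: component `i` is
  -- included in the total module, projected to `P j`, and read back at `i`. Their composites sum to
  -- `1` because the `p j` do.
  let a : ∀ j, Y.Total →ₗ[Alg S d] (flat (f := f) μ hμ (P j)).Total := fun j =>
    mapTotal (fun i => ((p j).restrictScalars S) ∘ₗ Y.incl i) (fun i x => by
      change p j (Y.incl i (Y.φ i x)) = μ • z S d f • p j (Y.incl (i + 1) x)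
      rw [← map_smul (p j), ← LinearMap.CompatibleSMul.map_smul (p j) μ, hμz, cyc_incl])
  let b : ∀ j, (flat (f := f) μ hμ (P j)).Total →ₗ[Alg S d] Y.Total := fun j =>
    mapTotal (fun i => Y.proj i ∘ₗ (P j).subtype.restrictScalars S) (fun i x => by
      change Y.proj i (μ • z S d f • ((show P j from x : P j) : Y.Total)) =
        Y.φ i (Y.proj (i + 1) ((show P j from x : P j) : Y.Total))
      rw [hμz, proj_cyc])
  have hone : ∑ j, (b j ∘ₗ a j : Module.End (Alg S d) Y.Total) = 1 := by
    ext x i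
    have h1 : ∀ j, Y.proj i ((b j ∘ₗ a j) x) =
      Y.proj i (p j (Y.incl i (Y.proj i x)) : Y.Total) := fun j => rfl
    rw [LinearMap.sum_apply, map_sum, Finset.sum_congr rfl fun j _ => h1 j, ← map_sum, hsum,
      proj_incl]
    rfl
  obtain ⟨j, -, hj⟩ := exists_isUnit_of_sum_eq_one Finset.univ
    (fun j => (b j ∘ₗ a j : Module.End (Alg S d) Y.Total)) (hone ▸ isUnit_one)
  obtain ⟨k, ⟨e⟩⟩ := hM (ModuleCat.of _ (P j)) (hUlrich j) (hP j)
  obtain ⟨X, hX, e'⟩ := hL k (P j) e Y hYind (a j) (b j) hj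
  exact ⟨X, List.mem_flatMap.mpr ⟨k, List.mem_finRange k, hX⟩, e'⟩

theorem hasFiniteUlrichType_of_hasFiniteReducedMFType (hdu : IsUnit (d : S))
    (h : HasFiniteReducedMFType S d f) : HasFiniteUlrichType (BranchedCover S d f) := by
  have := isDomain_of_isRegularLocalRing S
  have hd := NeZero.ne d
  have hf1 : f ∈ maximalIdeal S := Ideal.pow_le_self hd hf
  obtain ⟨n, X, hX⟩ := h
  choose L hL using fun k => BranchedCover.exists_list_of_retract hf0 hf1 ν hν (X k)
  suffices H : ∀ N : ModuleCat.{u} (BranchedCover S d f), IsUlrich (BranchedCover S d f) N →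
      IsIndecomposableModule (BranchedCover S d f) N →
      ∃ M ∈ (List.finRange n).flatMap L, Nonempty (N ≃ₗ[BranchedCover S d f] M) by
    refine ⟨_, ((List.finRange n).flatMap L).get, fun N hN hN' => ?_⟩
    obtain ⟨M, hM, e⟩ := H N hN hN'
    obtain ⟨i, rfl⟩ := List.mem_iff_get.mp hM
    exact ⟨i, e⟩
  intro N hNU hNind
  let _ : Module S N := Module.compHom N (algebraMap S (BranchedCover S d f))
  have : IsScalarTower S (BranchedCover S d f) N :=
    ⟨fun s r x => (congrArg (· • x) (Algebra.smul_def s r)).trans (mul_smul _ r x)⟩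
  obtain ⟨hfree, hfin⟩ := free_and_finite_of_isMCM hd hf1 N hNU.1
  have hN' : IsIndecModule (BranchedCover S d f) N := hNind
  have := hN'.1
  have := hN'.isLocalRing_end S
  have hred : (flat (f := f) μ hμ N).IsReduced :=
    (flat_isReduced_iff N μ hd hμ).mpr ((isUlrich_iff (S := S) N hd hf).mp hNU)
  set W := flat (f := f) μ hμ N
  obtain ⟨c, hc⟩ := hdu.exists_left_inv
  -- The diagonal and the average, with `c = 1/d`, exhibit `N` as a retract of the total module of
  -- `N♭`. Both are compatible with `z` because `ν μ = 1` and the sum over `ZMod d` is invariant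
  -- under the cyclic shift.
  let diag : N →ₗ[S] W.Total := ⟨⟨fun x _ => x, fun _ _ => rfl⟩, fun _ _ => rfl⟩
  let avg : W.Total →ₗ[S] N :=
    { toFun := fun x => c • ∑ i, (show N from x i)
      map_add' := fun x y => by
        rw [← smul_add, ← Finset.sum_add_distrib]; rfl
      map_smul' := fun s x => by
        rw [RingHom.id_apply, smul_comm s c, Finset.smul_sum (r := s)]; rfl }
  have havg : ∀ x : W.Total, avg x = c • ∑ i, (show N from x i) := fun _ => rfl
  have hdiag : ∀ x : N, diag (z S d f • x) = ν • W.cyc (diag x) := by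
    intro x
    funext i
    change z S d f • x = ν • μ • z S d f • x
    rw [smul_smul, mul_comm, hμν, one_smul]
  have hcyc : ∀ x : W.Total, avg (ν • W.cyc x) = z S d f • avg x := by
    intro x
    have h1 : ∀ i, (show N from (ν • W.cyc x) i) = z S d f • (show N from x (i + 1)) := by
      intro i
      change ν • μ • z S d f • (show N from x (i + 1)) = _
      rw [smul_smul, mul_comm, hμν, one_smul]
    rw [havg, havg, Finset.sum_congr rfl fun i _ => h1 i, ← Finset.smul_sum, smul_comm]
    exact congrArg (fun y : N => z S d f • c • y)
      (Equiv.sum_comp (Equiv.addRight (1 : ZMod d)) (fun i => (show N from x i)))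
  have havgdiag : ∀ x, avg (diag x) = x := by
    intro x
    rw [havg]
    change c • ∑ _i : ZMod d, x = x
    rw [Finset.sum_const, Finset.card_univ, ZMod.card, ← Nat.cast_smul_eq_nsmul S, smul_smul, hc,
      one_smul]
  obtain ⟨ι, _, P, p, hp, hsum, hP⟩ :=
    exists_indecomposable_decomposition (Λ := Alg S d) S W.Total
  have hcomm : ∀ j (x : W.Total), ((p j (ν • W.cyc x) : P j) : W.Total) =
      ν • W.cyc (p j x : W.Total) := by
    intro j x
    rw [LinearMap.CompatibleSMul.map_smul (p j) ν, ← ι_none_smul, map_smul, ← ι_none_smul]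
    rfl
  -- The identity of `N` is the sum of its passages through the indecomposable summands of `N♭`. One
  -- passage is a unit, so `N` is a retract of the total module of a single reduced indecomposable
  -- matrix factorization.
  let T : ι → Module.End (BranchedCover S d f) N := fun j =>
    linearMapOfMapZSMul hd hf1
      (avg ∘ₗ (((P j).subtype ∘ₗ p j).restrictScalars S) ∘ₗ diag) (fun x => by
        change avg (p j (diag (z S d f • x)) : W.Total) = z S d f • avg (p j (diag x) : W.Total)
        rw [hdiag, hcomm, hcyc])
  have hT : ∀ j x, T j x = avg (p j (diag x) : W.Total) := fun _ _ => rfl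
  have hone : ∑ j, T j = 1 := by
    ext x
    rw [LinearMap.sum_apply, Finset.sum_congr rfl fun j _ => hT j x, ← map_sum, hsum, havgdiag]
    rfl
  obtain ⟨j, -, hj⟩ := exists_isUnit_of_sum_eq_one Finset.univ T (hone ▸ isUnit_one)
  let E₀ := summandTotal (P j) hf0 (p j) (hp j)
  obtain ⟨k, ⟨e⟩⟩ := hX (summand (P j) hf0 (p j) (hp j)) (isReduced_summand _ _ _ _ hred)
    (isIndecomposable_of_total ((hP j).congr E₀.symm))
  let E := E₀.symm.trans e.total
  obtain ⟨M, hM, e'⟩ := hL k N hN'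
    (((E.toLinearMap ∘ₗ p j).restrictScalars S) ∘ₗ diag)
    (avg ∘ₗ (((P j).subtype ∘ₗ E.symm.toLinearMap).restrictScalars S)) (fun x => by
      change E (p j (diag (z S d f • x))) = ν • (X k).cyc (E (p j (diag x)))
      rw [hdiag, ← ι_none_smul, ← ι_none_smul, LinearMap.CompatibleSMul.map_smul (p j) ν,
        ← LinearEquiv.coe_coe, LinearMap.CompatibleSMul.map_smul E.toLinearMap ν, map_smul, map_smul])
    (fun x => by
      change avg ((E.symm (ν • (X k).cyc x) : P j) : W.Total) =
        z S d f • avg ((E.symm x : P j) : W.Total)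
      have h1 : ((E.symm (ν • (X k).cyc x) : P j) : W.Total) =
          ν • W.cyc ((E.symm x : P j) : W.Total) := by
        rw [← LinearEquiv.coe_coe, LinearMap.CompatibleSMul.map_smul E.symm.toLinearMap ν,
          ← ι_none_smul, map_smul, ← ι_none_smul]
        rfl
      rw [h1, hcyc])
    (by
      convert (Module.End.isUnit_iff _).mp hj using 1
      funext x
      change avg ((E.symm (E (p j (diag x))) : P j) : W.Total) = _
      rw [E.symm_apply_apply]
      rfl)
  exact ⟨M, List.mem_flatMap.mpr ⟨k, List.mem_finRange k, hM⟩, e'⟩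

end

/-! ### The main theorem. -/

theorem theoremC {S : Type u} [CommRing S] [IsRegularLocalRing S]
    [IsAdicComplete (maximalIdeal S) S] [IsAlgClosed (ResidueField S)]
    (d : ℕ) (hd : 2 ≤ d) (hchar : (d : ResidueField S) ≠ 0)
    (f : S) (hf0 : f ≠ 0) (hf2 : f ∈ maximalIdeal S ^ 2)
    (hord : (d : ℕ∞) ≤ maxIdealOrder S f)
    (hirr : Irreducible (C f + X ^ d : S⟦X⟧)) :
    haveI : IsLocalRing (BranchedCover S d f) := BranchedCover.isLocalRing hd hf2
    (∃ μ : S, μ ^ d = -1) ∧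
    (∀ (μ : S) (hμ : μ ^ d = -1) (N : Type u) [AddCommGroup N]
      [Module (BranchedCover S d f) N] [Module S N] [IsScalarTower S (BranchedCover S d f) N],
      IsMCM (BranchedCover S d f) N →
        ∃ (_ : Module.Free S N) (_ : Module.Finite S N),
          IsUlrich (BranchedCover S d f) N ↔
            (BranchedCover.flat (f := f) μ hμ N).IsReduced) ∧
    (HasFiniteReducedMFType S d f ↔ HasFiniteUlrichType (BranchedCover S d f)) := by
  have : IsLocalRing (BranchedCover S d f) := BranchedCover.isLocalRing hd hf2
  have hd0 : d ≠ 0 := by omega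
  have : NeZero d := ⟨hd0⟩
  have hfd := mem_maximalIdeal_pow_of_le_maxIdealOrder hord
  have hf1 : f ∈ maximalIdeal S := Ideal.pow_le_self hd0 hfd
  obtain ⟨μ, hμ⟩ := exists_pow_eq_neg_one (S := S) d hchar
  refine ⟨⟨μ, hμ⟩, ?_, ?_⟩
  · intro μ hμ N _ _ _ _ hN
    obtain ⟨hfree, hfin⟩ := BranchedCover.free_and_finite_of_isMCM hd0 hf1 N hN
    exact ⟨hfree, hfin, (BranchedCover.isUlrich_iff (S := S) N hd0 hfd).trans
      (BranchedCover.flat_isReduced_iff N μ hd0 hμ).symm⟩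
  · have hμu : IsUnit μ := (isUnit_pow_iff hd0).mp (hμ ▸ isUnit_one.neg)
    obtain ⟨ν, hμν⟩ := hμu.exists_right_inv
    -- The inverse of `μ` is again a `d`-th root of `-1`, as `-1` is its own inverse; it is the
    -- scalar through which `z` acts on total modules.
    have hν : ν ^ d = -1 := by
      have := congrArg (· ^ d) hμν
      simp only [mul_pow, hμ, one_pow] at this
      linear_combination -this
    have hdu : IsUnit (d : S) := by
      rw [← residue_ne_zero_iff_isUnit]
      simpa using hchar
    exact ⟨hasFiniteUlrichType_of_hasFiniteReducedMFType hf0 hfd hμ hν hμν hdu,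
      hasFiniteReducedMFType_of_hasFiniteUlrichType hf0 hfd hμ hν hμν⟩
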